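/- Conventions. A CAT(0) space is a complete geodesic metric space whose geodesic triangles are at least as thin as their Euclidean comparison triangles. A bounded sequence $(x_n)$ in a CAT(0) space $X$ converges weakly to $x\in X$ if for every compact geodesic $c$ starting at $x$ the closest-point projections of $x_n$ to $c$ converge to $x$. The weak topology $\mathcal T_\Delta$ on $X$ is the topology whose closed sets are the sets that contain every weak limit of every bounded sequence of their elements. The coconvex topology $\mathcal T_{co}$ is the coarsest topology on $X$ for which all metrically closed, convex subsets are closed. Construction. Let $Y_1$ be the metric tree obtained from countably infinitely many intervals $[0,\frac{\pi}{4}]$ by gluing them together at $0$. Fix one endpoint of $Y_1$, and let $Y$ be the metric tree obtained from countably infinitely many copies of $Y_1$ by gluing them together at this endpoint. Let $p\in Y$ be the gluing point, let $B\subset Y$ be the set of branching points different from $p$ (the centres of the copies of $Y_1$, at distance $\frac{\pi}{4}$ from $p$), and let $E\subset Y$ be the set of endpoints of $Y$. Let $\hat X$ be the Euclidean cone over $Y$ with tip $o$, that is, the set of points $s\cdot y$ with $s\ge 0$, $y\in Y$ and $0\cdot y=o$ for all $y$, with the metric $$d(s\cdot y,t\cdot y')^2=s^2+t^2-2st\cos\bigl(\min\{d_Y(y,y'),\pi\}\bigr).$$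 Identify $y\in Y$ with $1\cdot y\in\hat X$. Every edge of $Y$ has length $\frac{\pi}{4}$; for an edge with endpoints $y,y'$ let $S_{y,y'}\subset\hat X$ be the solid triangle with vertices $o,\,2\cdot y,\,2\cdot y'$, and let $X\subset\hat X$ be the union of the triangles $S_{y,y'}$ over all edges of $Y$, with the metric induced from $\hat X$. Put $$A = E\cup \tfrac{1}{\sqrt 2}\cdot B\cup\{\tfrac12\cdot p\}\cup\{o\}.$$ Statement. $X$ is a bounded CAT(0) space and $A\subset X$. The set $A$ is $\mathcal T_\Delta$-closed, whereas the point $\tfrac14\cdot p\in X\setminus A$ lies in the $\mathcal T_{co}$-closure of $A$. In particular, the topologies $\mathcal T_\Delta$ and $\mathcal T_{co}$ on $X$ do not coincide. -/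

import Mathlib

open scoped NNReal Topology

/-! ### CAT(0) spaces, weak convergence, and the two topologies -/

/-- `γ`, restricted to `[0, L]`, is a geodesic parametrized by arc length. -/
def IsGeodesic {X : Type} [MetricSpace X] (γ : ℝ → X) (L : ℝ) : Prop :=
  0 ≤ L ∧ ∀ s ∈ Set.Icc 0 L, ∀ t ∈ Set.Icc 0 L, dist (γ s) (γ t) = |s - t|

/-- `z` satisfies `d(x,z) + d(z,y) = d(x,y)`. In a geodesic space this says that `z` lies on
some geodesic from `x` to `y`. -/
def MetricBetween {X : Type} [MetricSpace X] (x z y : X) : Prop :=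
  dist x z + dist z y = dist x y

/-- A complete geodesic metric space in which every geodesic triangle is at least as thin as
its comparison triangle in the Euclidean plane: if `x` lies on a side `[p,q]`, `y` on a side
`[p,r]`, and `x'`, `y'` are the comparison points in a comparison triangle `p' q' r'`, then
`d(x,y) ≤ |x' - y'|`. -/
structure IsCAT0 (X : Type) [MetricSpace X] : Prop where
  complete : CompleteSpace X
  geodesic : ∀ x y : X, ∃ γ : ℝ → X,
    IsGeodesic γ (dist x y) ∧ γ 0 = x ∧ γ (dist x y) = y
  thin : ∀ (p q r x y : X) (p' q' r' x' y' : EuclideanSpace ℝ (Fin 2)),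
    dist p' q' = dist p q → dist q' r' = dist q r → dist p' r' = dist p r →
    MetricBetween p x q → dist p' x' = dist p x → dist x' q' = dist x q →
    MetricBetween p y r → dist p' y' = dist p y → dist y' r' = dist y r →
    dist x y ≤ dist x' y'

/-- `q` is a closest point of `S` to `x`. -/
def IsClosestPoint {X : Type} [MetricSpace X] (S : Set X) (x q : X) : Prop :=
  q ∈ S ∧ ∀ w ∈ S, dist x q ≤ dist x w

/-- For every compact geodesic `c` starting at `x`, the closest-point projections of `u n` to
`c` converge to `x`. -/
def WeaklyConverges {X : Type} [MetricSpace X] (u : ℕ → X) (x : X) : Prop :=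
  ∀ (γ : ℝ → X) (L : ℝ), IsGeodesic γ L → γ 0 = x →
    ∀ ε > 0, ∀ᶠ n in Filter.atTop,
      ∀ q, IsClosestPoint (γ '' Set.Icc 0 L) (u n) q → dist q x < ε

/-- `A` contains all weak limits of bounded sequences of its elements. -/
def IsWeaklyClosed {X : Type} [MetricSpace X] (A : Set X) : Prop :=
  ∀ (u : ℕ → X) (x : X), (∀ n, u n ∈ A) → Bornology.IsBounded (Set.range u) →
    WeaklyConverges u x → x ∈ A

theorem WeaklyConverges.subseq {X : Type} [MetricSpace X] {u : ℕ → X} {x : X}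
    (h : WeaklyConverges u x) {φ : ℕ → ℕ} (hφ : StrictMono φ) :
    WeaklyConverges (u ∘ φ) x :=
  fun γ L hγ h0 ε hε => hφ.tendsto_atTop.eventually (h γ L hγ h0 ε hε)

theorem IsWeaklyClosed.union {X : Type} [MetricSpace X] {A B : Set X}
    (hA : IsWeaklyClosed A) (hB : IsWeaklyClosed B) : IsWeaklyClosed (A ∪ B) := by
  intro u x hu hb hx
  have key : ∀ C : Set X, IsWeaklyClosed C → (∃ᶠ n in Filter.atTop, u n ∈ C) → x ∈ C := by
    intro C hC hf
    obtain ⟨φ, hφ, hφC⟩ := Filter.extraction_of_frequently_atTop hf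
    exact hC (u ∘ φ) x hφC (hb.subset (Set.range_comp_subset_range φ u)) (hx.subseq hφ)
  have hf : ∃ᶠ n in Filter.atTop, u n ∈ A ∨ u n ∈ B :=
    Filter.Frequently.of_forall hu
  rcases Filter.frequently_or_distrib.1 hf with h | h
  · exact Or.inl (key A hA h)
  · exact Or.inr (key B hB h)

/-- The weak topology: its closed sets are the sets that contain all weak limits of bounded
sequences of their elements. -/
@[reducible]
def weakTopology (X : Type) [MetricSpace X] : TopologicalSpace X :=
  TopologicalSpace.ofClosed {A : Set X | IsWeaklyClosed A}
    (fun _ _ hu _ _ => (hu 0).elim)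
    (fun _ hS u x hu hb hx A hA => hS hA u x (fun n => hu n A hA) hb hx)
    (fun _ hA _ hB => hA.union hB)

/-- Geodesic convexity: together with two points, `C` contains every geodesic between them. -/
def IsGeodConvex {X : Type} [MetricSpace X] (C : Set X) : Prop :=
  ∀ x ∈ C, ∀ y ∈ C, ∀ z, MetricBetween x z y → z ∈ C

/-- The coconvex topology: the coarsest topology for which all metrically closed convex sets
are closed. -/
@[reducible]
def coconvexTopology (X : Type) [MetricSpace X] : TopologicalSpace X :=
  TopologicalSpace.generateFrom {U : Set X | IsClosed Uᶜ ∧ IsGeodConvex Uᶜ}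

/-! ### Gluing countably many copies of a pointed metric space at the base point -/

/-- The disjoint union of countably many copies of `Z`; its pseudometric below is the gluing
metric, for which the copies of `z` have distance zero. -/
structure PreWedge (Z : Type) (z : Z) where
  idx : ℕ
  pt : Z

noncomputable instance (Z : Type) [MetricSpace Z] (z : Z) :
    PseudoMetricSpace (PreWedge Z z) where
  dist a b := if a.idx = b.idx then dist a.pt b.pt else dist a.pt z + dist z b.pt
  dist_self a := by simp
  dist_comm a b := by
    by_cases h : a.idx = b.idx
    · rw [if_pos h, if_pos h.symm, dist_comm]
    · rw [if_neg h, if_neg (Ne.symm h), add_comm, dist_comm z, dist_comm a.pt]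
  dist_triangle a b c := by
    have h1 := dist_triangle a.pt b.pt c.pt
    have h2 := dist_triangle a.pt z c.pt
    have h3 := dist_triangle a.pt b.pt z
    have h4 := dist_triangle z b.pt c.pt
    have h5 : 0 ≤ dist b.pt z := dist_nonneg
    have h6 := dist_comm z b.pt
    split_ifs <;> first | linarith | (exfalso; omega)

/-- Countably many copies of `Z`, glued together at `z` by identifying the copies of `z`. -/
abbrev Wedge (Z : Type) [MetricSpace Z] (z : Z) : Type :=
  SeparationQuotient (PreWedge Z z)

/-- The point `x` of the `n`-th copy. -/
noncomputable def Wedge.mk {Z : Type} [MetricSpace Z] (z : Z) (n : ℕ) (x : Z) : Wedge Z z :=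
  SeparationQuotient.mk ⟨n, x⟩

/-! ### The Euclidean cone -/

/-- Pairs of a radius and a direction; for the pseudometric below, all pairs of radius zero
have distance zero. -/
structure PreCone (Y : Type) where
  rad : ℝ≥0
  dir : Y

/-- The third side of a planar triangle with sides `s`, `t` enclosing the angle `α`. -/
noncomputable def cosineSide (s t α : ℝ) : ℝ :=
  Real.sqrt (s ^ 2 + t ^ 2 - 2 * s * t * Real.cos α)

theorem cosineSide_planar (s u α β : ℝ) :
    cosineSide s u (α + β) =
      ‖(s : ℂ) * Complex.exp (α * Complex.I) - u * Complex.exp ((-β : ℝ) * Complex.I)‖ := by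
  rw [cosineSide, Complex.norm_def, Complex.normSq_apply]
  congr 1
  simp only [Complex.sub_re, Complex.sub_im, Complex.re_ofReal_mul, Complex.im_ofReal_mul,
    Complex.exp_ofReal_mul_I_re, Complex.exp_ofReal_mul_I_im, Real.cos_neg, Real.sin_neg,
    Real.cos_add]
  have h1 := Real.sin_sq_add_cos_sq α
  have h2 := Real.sin_sq_add_cos_sq β
  linear_combination (-s ^ 2) * h1 + (-u ^ 2) * h2

theorem cosineSide_triangle_planar (s t u α β : ℝ) :
    cosineSide s u (α + β) ≤ cosineSide s t α + cosineSide t u β := by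
  have h1 := cosineSide_planar s u α β
  have h2 := cosineSide_planar s t α 0
  have h3 := cosineSide_planar t u 0 β
  rw [add_zero] at h2
  rw [zero_add] at h3
  rw [h1, h2, h3]
  simp only [neg_zero, Complex.ofReal_zero, zero_mul, Complex.exp_zero, mul_one]
  exact norm_sub_le_norm_sub_add_norm_sub _ _ _

theorem cosineSide_mono {s t α β : ℝ} (hs : 0 ≤ s) (ht : 0 ≤ t) (hα : 0 ≤ α) (hβ : β ≤ Real.pi)
    (h : α ≤ β) : cosineSide s t α ≤ cosineSide s t β := by
  apply Real.sqrt_le_sqrt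
  have h1 := Real.cos_le_cos_of_nonneg_of_le_pi hα hβ h
  have h2 := mul_le_mul_of_nonneg_left h1 (mul_nonneg hs ht)
  linarith

theorem cosineSide_triangle {s t u α β γ : ℝ} (hs : 0 ≤ s) (ht : 0 ≤ t) (hu : 0 ≤ u)
    (hα' : α ≤ Real.pi) (hβ' : β ≤ Real.pi)
    (hγ : 0 ≤ γ) (hγ' : γ ≤ Real.pi) (h : γ ≤ α + β) :
    cosineSide s u γ ≤ cosineSide s t α + cosineSide t u β := by
  rcases le_total (α + β) Real.pi with h1 | h1
  · exact (cosineSide_mono hs hu hγ h1 h).trans (cosineSide_triangle_planar s t u α β)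
  · have h2 := cosineSide_triangle_planar s t u (Real.pi - β) β
    rw [sub_add_cancel] at h2
    have h3 := cosineSide_mono (s := s) (t := u) hs hu hγ le_rfl hγ'
    have h4 := cosineSide_mono (s := s) (t := t) (α := Real.pi - β) (β := α) hs ht
      (by linarith) hα' (by linarith)
    linarith

noncomputable instance (Y : Type) [MetricSpace Y] : PseudoMetricSpace (PreCone Y) where
  dist a b := cosineSide a.rad b.rad (min (dist a.dir b.dir) Real.pi)
  dist_self a := by
    have h : min 0 Real.pi = 0 := min_eq_left Real.pi_pos.le
    simp only [dist_self, h, cosineSide, Real.cos_zero]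
    rw [← Real.sqrt_zero]
    congr 1
    ring
  dist_comm a b := by
    simp only [dist_comm b.dir, cosineSide]
    congr 1
    ring
  dist_triangle a b c := by
    have hp := Real.pi_pos.le
    refine cosineSide_triangle a.rad.2 b.rad.2 c.rad.2 (min_le_right _ _)
      (min_le_right _ _) (le_min dist_nonneg hp) (min_le_right _ _) ?_
    have h1 := dist_triangle a.dir b.dir c.dir
    have h2 : 0 ≤ dist a.dir b.dir := dist_nonneg
    have h3 : 0 ≤ dist b.dir c.dir := dist_nonneg
    simp only [min_def]
    split_ifs <;> linarith

/-- The Euclidean cone over `Y`, with metric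
`d(s·x, t·y)² = s² + t² - 2 s t cos (min (d(x,y)) π)`. -/
abbrev EuclCone (Y : Type) [MetricSpace Y] : Type :=
  SeparationQuotient (PreCone Y)

/-- The point `r · y` on the ray in direction `y`, at distance `r` from the tip. -/
noncomputable def EuclCone.ray {Y : Type} [MetricSpace Y] (r : ℝ≥0) (y : Y) : EuclCone Y :=
  SeparationQuotient.mk ⟨r, y⟩

/-! ### The example -/

namespace Example

/-- The interval `[0, π/4]`. -/
abbrev Edge : Type := Set.Icc (0 : ℝ) (Real.pi / 4)

noncomputable def edgeStart : Edge := ⟨0, le_rfl, by positivity⟩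

noncomputable def edgeEnd : Edge := ⟨Real.pi / 4, by positivity, le_rfl⟩

/-- Countably many intervals `[0, π/4]`, glued together at `0`. -/
abbrev Y₁ : Type := Wedge Edge edgeStart

/-- The point of `Y₁` at which the intervals are glued. -/
noncomputable def centre : Y₁ := Wedge.mk edgeStart 0 edgeStart

/-- The countably many endpoints of `Y₁`. -/
noncomputable def endpt (k : ℕ) : Y₁ := Wedge.mk edgeStart k edgeEnd

/-- The tree: countably many copies of `Y₁`, glued together at the endpoint number `0`. -/
abbrev Y : Type := Wedge Y₁ (endpt 0)

/-- The point at which the copies of `Y₁` are glued. -/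
noncomputable def p : Y := Wedge.mk (endpt 0) 0 (endpt 0)

/-- The branching points different from `p`: the centres of the copies of `Y₁`. -/
noncomputable def b (n : ℕ) : Y := Wedge.mk (endpt 0) n centre

/-- The far ends of the edges of `Y` at `b n`. For `k = 0` this is `p`, for `k ≥ 1` it is an
endpoint of `Y`. The edges of `Y` are the segments from `b n` to `e n k`. -/
noncomputable def e (n k : ℕ) : Y := Wedge.mk (endpt 0) n (endpt k)

/-- The tip of the cone over `Y`. -/
noncomputable def o : EuclCone Y := EuclCone.ray 0 p

/-- The solid triangle with vertices `o`, `2·y`, `2·y'`: the union of the segments from `o` to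
the points of the segment from `2·y` to `2·y'`. -/
def triangle (y y' : Y) : Set (EuclCone Y) :=
  {z | ∃ w, MetricBetween (EuclCone.ray 2 y) w (EuclCone.ray 2 y') ∧ MetricBetween o z w}

/-- The union of the triangles over all edges of `Y`. As a type it carries the metric of the
cone. -/
def X : Set (EuclCone Y) := ⋃ (n : ℕ) (k : ℕ), triangle (b n) (e n k)

/-- The branching points of `Y` different from `p`. -/
def B : Set Y := {y | ∃ n, y = b n}

/-- The endpoints of `Y`. -/
def E : Set Y := {y | ∃ n k, 1 ≤ k ∧ y = e n k}

/-- The set `E ∪ (1/√2)·B ∪ {(1/2)·p} ∪ {o}`, where `Y` is identified with the unit sphere of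
the cone. -/
noncomputable def A : Set (EuclCone Y) :=
  EuclCone.ray 1 '' E ∪ EuclCone.ray (1 / NNReal.sqrt 2) '' B ∪ {EuclCone.ray (1 / 2) p} ∪ {o}

end Example

/-!
By Bruhat and Tits, a complete metric space is CAT(0) as soon as every segment has a barycentre in
every ratio, that is, a point satisfying the Euclidean formula for distances with `≤`. In the cone
over a metric tree of diameter at most `π`, the barycentre is found by dividing a planar triangle
with the same sides and the same angle at the tip, and then dividing the segment of directions in
the tree accordingly. The set `X` is closed and convex in the cone, being cut out by two orthogonal
projections, and so it inherits barycentres and completeness.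

Suppose that a sequence in `A` converges weakly to `x`, and that it is not constant along any
subsequence. Then along a subsequence all geodesics of `Y` from the directions of its terms to the
direction of `x` pass through one point `w ∈ {p} ∪ B` at a constant distance `π/4` or `π/2`. The
feet of the perpendiculars to the ray through `w` are all equal to a point of `A`, one of `o`,
`(1/√2) · b n` and `(1/2) · p`, and this point must be `x`.

If finitely many closed convex sets cover `A`, then by the pigeonhole principle one of them contains
two endpoints at each of two different points of `B`. By convexity it contains the midpoints
`(1/√2) · b m` and `(1/√2) · b n`, then their midpoint `(1/2) · p`, also the tip `o` as the midpoint
of two antipodal endpoints, and therefore `(1/4) · p`.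
-/

/-! ### Barycentres -/

section Barycentre

variable {M : Type*} [MetricSpace M] {s t : ℝ} {q r m m' : M}

/-- The comparison inequality of Bruhat and Tits: `m` behaves like the point `(1 - t) q + t r` of
a Euclidean segment, with `≤` in place of the equality of Stewart's theorem. A point with this
property is unique and divides a geodesic from `q` to `r` in the ratio `t : 1 - t`. -/
def IsBarycentre (t : ℝ) (q r m : M) : Prop :=
  ∀ p, dist p m ^ 2 ≤ (1 - t) * dist p q ^ 2 + t * dist p r ^ 2 - t * (1 - t) * dist q r ^ 2

namespace IsBarycentre

theorem symm (h : IsBarycentre t q r m) : IsBarycentre (1 - t) r q m := fun p => by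
  rw [dist_comm r q]
  exact (h p).trans_eq (by ring)

theorem eq_of_dist (h : IsBarycentre t q r m) (hq : dist q m' = t * dist q r)
    (hr : dist m' r = (1 - t) * dist q r) : m' = m := by
  have hsq := h m'
  rw [dist_comm m' q, hq, hr] at hsq
  have hle : dist m' m ^ 2 ≤ 0 := hsq.trans_eq (by ring)
  exact dist_eq_zero.1 (pow_eq_zero_iff two_ne_zero |>.1 (hle.antisymm (sq_nonneg _)))

theorem dist_left_le (h : IsBarycentre t q r m) (ht : 0 ≤ t) : dist q m ≤ t * dist q r := by
  refine (sq_le_sq₀ dist_nonneg (mul_nonneg ht dist_nonneg)).1 ((h q).trans_eq ?_)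
  rw [dist_self]
  ring

theorem dist_left (h : IsBarycentre t q r m) (ht : t ∈ Set.Icc (0 : ℝ) 1) :
    dist q m = t * dist q r := by
  have hr := h.symm.dist_left_le (sub_nonneg.2 ht.2)
  rw [dist_comm r m, dist_comm r q] at hr
  exact (h.dist_left_le ht.1).antisymm (by linarith [dist_triangle q m r])

theorem dist_right (h : IsBarycentre t q r m) (ht : t ∈ Set.Icc (0 : ℝ) 1) :
    dist m r = (1 - t) * dist q r := by
  have hr := h.symm.dist_left ⟨sub_nonneg.2 ht.2, sub_le_self _ ht.1⟩
  rwa [dist_comm r m, dist_comm r q] at hr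

theorem dist_eq (h : IsBarycentre s q r m) (h' : IsBarycentre t q r m')
    (hs : s ∈ Set.Icc (0 : ℝ) 1) (ht : t ∈ Set.Icc (0 : ℝ) 1) :
    dist m m' = |s - t| * dist q r := by
  apply le_antisymm
  · refine (sq_le_sq₀ dist_nonneg (by positivity)).1 ((h' m).trans_eq ?_)
    rw [dist_comm m q, h.dist_left hs, h.dist_right hs, mul_pow |s - t|, sq_abs]
    ring
  · rw [← abs_of_nonneg (dist_nonneg (x := q) (y := r)), ← abs_mul, sub_mul, ← h.dist_left hs,
      ← h'.dist_left ht, dist_comm q m, dist_comm q m']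
    exact abs_dist_sub_le m m' q

end IsBarycentre

/-- Every segment has a barycentre in every ratio. For a complete metric space this is the
inequality of Bruhat and Tits, an equivalent form of the CAT(0) condition. -/
def HasBarycentres (M : Type*) [MetricSpace M] : Prop :=
  ∀ q r : M, ∀ t ∈ Set.Icc (0 : ℝ) 1, ∃ m, IsBarycentre t q r m

theorem HasBarycentres.isBarycentre_of_dist (hM : HasBarycentres M) (ht : t ∈ Set.Icc (0 : ℝ) 1)
    (hq : dist q m = t * dist q r) (hr : dist m r = (1 - t) * dist q r) :
    IsBarycentre t q r m := by
  obtain ⟨m', hm'⟩ := hM q r t ht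
  rwa [hm'.eq_of_dist hq hr]

theorem dist_sq_lineMap {V P : Type*} [NormedAddCommGroup V] [InnerProductSpace ℝ V]
    [MetricSpace P] [NormedAddTorsor V P] (t : ℝ) (p q r : P) :
    dist p (AffineMap.lineMap q r t) ^ 2 =
      (1 - t) * dist p q ^ 2 + t * dist p r ^ 2 - t * (1 - t) * dist q r ^ 2 := by
  have hm : AffineMap.lineMap q r t -ᵥ p = (q -ᵥ p) + t • (r -ᵥ q) := by
    rw [AffineMap.lineMap_apply, vadd_vsub_assoc, add_comm]
  have hr : r -ᵥ p = (q -ᵥ p) + (r -ᵥ q) := by rw [add_comm, vsub_add_vsub_cancel]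
  rw [dist_comm p, dist_comm p q, dist_comm p r, dist_comm q r]
  simp only [dist_eq_norm_vsub V]
  rw [hm, hr, norm_add_sq_real, norm_add_sq_real, real_inner_smul_right, norm_smul, mul_pow,
    Real.norm_eq_abs, sq_abs]
  ring

end Barycentre

section

variable {M : Type} [MetricSpace M]

theorem MetricBetween.exists_ratio {q r m : M} (h : MetricBetween q m r) :
    ∃ t ∈ Set.Icc (0 : ℝ) 1, dist q m = t * dist q r ∧ dist m r = (1 - t) * dist q r := by
  have hqm : 0 ≤ dist q m := dist_nonneg
  have hmr : 0 ≤ dist m r := dist_nonneg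
  rw [MetricBetween] at h
  rcases (dist_nonneg (x := q) (y := r)).eq_or_lt with h0 | hpos
  · exact ⟨0, by simp, by linarith, by linarith⟩
  · refine ⟨dist q m / dist q r, ⟨by positivity, (div_le_one hpos).2 (by linarith)⟩, ?_, ?_⟩
    · rw [div_mul_cancel₀ _ hpos.ne']
    · rw [sub_mul, div_mul_cancel₀ _ hpos.ne']
      linarith

namespace HasBarycentres

theorem exists_geodesic (hM : HasBarycentres M) (x y : M) :
    ∃ γ : ℝ → M, IsGeodesic γ (dist x y) ∧ γ 0 = x ∧ γ (dist x y) = y := by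
  have hL : 0 ≤ dist x y := dist_nonneg
  have hratio : ∀ s ∈ Set.Icc 0 (dist x y), s / dist x y ∈ Set.Icc (0 : ℝ) 1 := fun s hs =>
    ⟨div_nonneg hs.1 hL, div_le_one_of_le₀ hs.2 hL⟩
  have : Nonempty M := ⟨x⟩
  choose! m hm using hM x y
  have h0 := (hm 0 (by simp)).dist_left (by simp)
  have h1 := (hm 1 (by simp)).dist_right (by simp)
  rw [zero_mul, dist_eq_zero] at h0
  rw [sub_self, zero_mul, dist_eq_zero] at h1
  rcases hL.eq_or_lt with h | hpos
  · have hxy := dist_eq_zero.1 h.symm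
    refine ⟨fun _ => x, ⟨hL, fun s hs t ht => ?_⟩, rfl, hxy⟩
    rw [← h] at hs ht
    rw [le_antisymm hs.2 hs.1, le_antisymm ht.2 ht.1, dist_self, sub_self, abs_zero]
  · refine ⟨fun s => m (s / dist x y), ⟨hL, fun s hs t ht => ?_⟩, ?_, ?_⟩
    · rw [(hm _ (hratio s hs)).dist_eq (hm _ (hratio t ht)) (hratio s hs) (hratio t ht),
        ← sub_div, abs_div, abs_of_pos hpos, div_mul_cancel₀ _ hpos.ne']
    · simp only [zero_div, ← h0]
    · simp only [div_self hpos.ne', h1]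

theorem isCAT0 [CompleteSpace M] (hM : HasBarycentres M) : IsCAT0 M where
  complete := inferInstance
  geodesic := hM.exists_geodesic
  thin := by
    intro p q r x y p' q' r' x' y' hpq hqr hpr hx hpx hxq hy hpy hyr
    obtain ⟨s, hs, hs₁, hs₂⟩ := hx.exists_ratio
    obtain ⟨t, ht, ht₁, ht₂⟩ := hy.exists_ratio
    have hx' : x' = AffineMap.lineMap p' q' s :=
      eq_lineMap_of_dist_eq_mul_of_dist_eq_mul (by rw [hpx, hpq, hs₁]) (by rw [hxq, hpq, hs₂])
    have hy' : y' = AffineMap.lineMap p' r' t :=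
      eq_lineMap_of_dist_eq_mul_of_dist_eq_mul (by rw [hpy, hpr, ht₁]) (by rw [hyr, hpr, ht₂])
    have hrx : dist x r ≤ dist x' r' := by
      refine (sq_le_sq₀ dist_nonneg dist_nonneg).1 ?_
      rw [dist_comm x r, dist_comm x' r', hx', dist_sq_lineMap, dist_comm r' p', hpr,
        dist_comm r' q', hqr, hpq, dist_comm p r, dist_comm q r]
      exact hM.isBarycentre_of_dist hs hs₁ hs₂ r
    refine (sq_le_sq₀ dist_nonneg dist_nonneg).1 ?_
    rw [hy', dist_sq_lineMap, dist_comm x' p', hpx, hpr, dist_comm p x]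
    refine (hM.isBarycentre_of_dist ht ht₁ ht₂ x).trans ?_
    have hsq := pow_le_pow_left₀ dist_nonneg hrx 2
    linarith [mul_le_mul_of_nonneg_left hsq ht.1]

theorem of_isGeodConvex (hM : HasBarycentres M) {C : Set M} (hC : IsGeodConvex C) :
    HasBarycentres C := by
  intro q r t ht
  obtain ⟨m, hm⟩ := hM q r t ht
  have hbetween : MetricBetween (q : M) m r := by
    rw [MetricBetween, hm.dist_left ht, hm.dist_right ht]
    ring
  exact ⟨⟨m, hC q q.2 r r.2 m hbetween⟩, fun x => hm x⟩

end HasBarycentres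

end

/-! ### Weak convergence and coconvex closures -/

section

variable {M : Type} [MetricSpace M]

theorem IsGeodesic.isCompact_image {γ : ℝ → M} {L : ℝ} (hγ : IsGeodesic γ L) :
    IsCompact (γ '' Set.Icc 0 L) := by
  have hlip : LipschitzOnWith 1 γ (Set.Icc 0 L) :=
    LipschitzOnWith.of_dist_le_mul fun s hs t ht => by
      rw [hγ.2 s hs t ht, Real.dist_eq, NNReal.coe_one, one_mul]
  exact isCompact_Icc.image_of_continuousOn hlip.continuousOn

theorem WeaklyConverges.eventually_dist_lt {u : ℕ → M} {x z : M} (h : WeaklyConverges u x)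
    {γ : ℝ → M} {L : ℝ} (hγ : IsGeodesic γ L) (h0 : γ 0 = x) (hL : γ L = z) {ε : ℝ} (hε : 0 < ε) :
    ∀ᶠ n in Filter.atTop, dist (u n) x < dist (u n) z + ε := by
  have hz : z ∈ γ '' Set.Icc 0 L := ⟨L, ⟨hγ.1, le_rfl⟩, hL⟩
  filter_upwards [h γ L hγ h0 ε hε] with n hn
  obtain ⟨q, hq, hmin⟩ :=
    hγ.isCompact_image.exists_isMinOn ⟨z, hz⟩ (continuous_const.dist continuous_id).continuousOn
  have hqx : dist q x < ε := hn q ⟨hq, fun w hw => hmin hw⟩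
  have hqz : dist (u n) q ≤ dist (u n) z := hmin hz
  linarith [dist_triangle (u n) q x]

theorem WeaklyConverges.eq_of_frequently {u : ℕ → M} {x z : M} (h : WeaklyConverges u x)
    (hu : Bornology.IsBounded (Set.range u)) {γ : ℝ → M} {L : ℝ} (hγ : IsGeodesic γ L)
    (h0 : γ 0 = x) (hL : γ L = z)
    (hobtuse : ∃ᶠ n in Filter.atTop, dist (u n) z ^ 2 + dist z x ^ 2 ≤ dist (u n) x ^ 2) :
    x = z := by
  by_contra hxz
  have hd : 0 < dist z x := dist_pos.2 (Ne.symm hxz)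
  obtain ⟨D, hD⟩ := hu.subset_closedBall z
  have huz : ∀ n, dist (u n) z ≤ D := fun n => hD (Set.mem_range_self n)
  have hD0 : 0 ≤ D := dist_nonneg.trans (huz 0)
  set ε := dist z x ^ 2 / (2 * D + dist z x) with hε
  have hεpos : 0 < ε := by positivity
  have hεD : ε * (2 * D + dist z x) = dist z x ^ 2 := div_mul_cancel₀ _ (by positivity)
  have hεd : ε ≤ dist z x := by
    rw [hε, div_le_iff₀ (by positivity)]
    nlinarith
  refine hobtuse ?_
  filter_upwards [h.eventually_dist_lt hγ h0 hL hεpos] with n hn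
  rw [not_le]
  calc dist (u n) x ^ 2 < (dist (u n) z + ε) ^ 2 := by gcongr
    _ = dist (u n) z ^ 2 + ε * (2 * dist (u n) z + ε) := by ring
    _ ≤ dist (u n) z ^ 2 + ε * (2 * D + dist z x) := by gcongr; exact huz n
    _ = dist (u n) z ^ 2 + dist z x ^ 2 := by rw [hεD]

theorem isClosed_weakTopology_iff {S : Set M} : IsClosed[weakTopology M] S ↔ IsWeaklyClosed S := by
  rw [← @isOpen_compl_iff _ _ (weakTopology M)]
  change IsWeaklyClosed Sᶜᶜ ↔ IsWeaklyClosed S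
  rw [compl_compl]

theorem mem_closure_coconvexTopology {S : Set M} {q : M}
    (h : ∀ f : Set (Set M), f.Finite → (∀ C ∈ f, IsClosed C ∧ IsGeodConvex C) → S ⊆ ⋃₀ f →
      q ∈ ⋃₀ f) :
    q ∈ @closure M (coconvexTopology M) S := by
  have hbasis := @TopologicalSpace.isTopologicalBasis_of_subbasis M (coconvexTopology M) _ rfl
  rw [@TopologicalSpace.IsTopologicalBasis.mem_closure_iff M (coconvexTopology M) _ hbasis]
  rintro _ ⟨f, ⟨hfin, hf⟩, rfl⟩ hq
  by_contra hdisjoint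
  rw [Set.not_nonempty_iff_eq_empty, ← Set.disjoint_iff_inter_eq_empty,
    ← Set.subset_compl_iff_disjoint_left, Set.compl_sInter] at hdisjoint
  obtain ⟨_, ⟨U, hU, rfl⟩, hqU⟩ :=
    h (compl '' f) (hfin.image _) (Set.forall_mem_image.2 fun U hU => hf hU) hdisjoint
  exact hqU (hq U hU)

end

theorem exists_monochromatic_pairs {ι κ c : Type*} [Infinite ι] [Infinite κ] [Finite c]
    (F : ι → κ → c) :
    ∃ m n k l k' l', m ≠ n ∧ k ≠ l ∧ k' ≠ l' ∧
      F m l = F m k ∧ F n k' = F m k ∧ F n l' = F m k := by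
  choose k l hkl hF using fun n => Finite.exists_ne_map_eq_of_infinite (F n)
  obtain ⟨m, n, hmn, hFmn⟩ := Finite.exists_ne_map_eq_of_infinite fun n => F n (k n)
  exact ⟨m, n, k m, l m, k n, l n, hmn, hkl m, hkl n, (hF m).symm, hFmn.symm,
    (hF n).symm.trans hFmn.symm⟩

/-! ### Metric trees -/

section

variable {M : Type*} [MetricSpace M] {a b : ℝ} {y y' z : M}

/-- `z` divides the segment from `y` to `y'` of a metric tree into parts of lengths `a` and `b`:
a path from any point to `z` can be extended to `y` or to `y'`. -/
def IsTreeDivision (a b : ℝ) (y y' z : M) : Prop :=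
  ∀ x, dist x z ≤ max (dist x y - a) (dist x y' - b)

/-- Any two points are joined by a segment as in a tree, expressed by the position of its points
relative to all other points. This describes geodesic `0`-hyperbolic spaces, that is, `ℝ`-trees. -/
def IsMetricTree (M : Type*) [MetricSpace M] : Prop :=
  ∀ (y y' : M) (a b : ℝ), 0 ≤ a → 0 ≤ b → a + b = dist y y' → ∃ z, IsTreeDivision a b y y' z

namespace IsTreeDivision

theorem symm (h : IsTreeDivision a b y y' z) : IsTreeDivision b a y' y z := fun x => by
  rw [max_comm]
  exact h x

theorem dist_left_le (h : IsTreeDivision a b y y' z) (ha : 0 ≤ a) (hab : a + b = dist y y') :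
    dist y z ≤ a := by
  refine (h y).trans (max_le ?_ ?_)
  · rw [dist_self]
    linarith
  · linarith

theorem dist_left (h : IsTreeDivision a b y y' z) (ha : 0 ≤ a) (hb : 0 ≤ b)
    (hab : a + b = dist y y') : dist y z = a := by
  have hright := h.symm.dist_left_le hb (by rw [dist_comm, ← hab, add_comm])
  rw [dist_comm] at hright
  exact (h.dist_left_le ha hab).antisymm (by linarith [dist_triangle y z y'])

theorem dist_right (h : IsTreeDivision a b y y' z) (ha : 0 ≤ a) (hb : 0 ≤ b)
    (hab : a + b = dist y y') : dist y' z = b :=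
  h.symm.dist_left hb ha (by rw [dist_comm, ← hab, add_comm])

theorem dist_eq_max (h : IsTreeDivision a b y y' z) (ha : 0 ≤ a) (hb : 0 ≤ b)
    (hab : a + b = dist y y') (x : M) : dist x z = max (dist x y - a) (dist x y' - b) := by
  refine (h x).antisymm (max_le ?_ ?_)
  · rw [← h.dist_left ha hb hab, sub_le_iff_le_add, dist_comm y z]
    exact dist_triangle x z y
  · rw [← h.dist_right ha hb hab, sub_le_iff_le_add, dist_comm y' z]
    exact dist_triangle x z y'

end IsTreeDivision

end

theorem isMetricTree_of_ordConnected (s : Set ℝ) [s.OrdConnected] : IsMetricTree s := by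
  have hle : ∀ (y y' : s) (a b : ℝ), 0 ≤ a → 0 ≤ b → a + b = dist y y' → y ≤ y' →
      ∃ z, IsTreeDivision a b y y' z := by
    rintro ⟨y, hy⟩ ⟨y', hy'⟩ a b ha hb hab hyy'
    rw [Subtype.mk_le_mk] at hyy'
    rw [Subtype.dist_eq, dist_comm, Real.dist_eq, abs_of_nonneg (sub_nonneg.2 hyy')] at hab
    refine ⟨⟨y + a, Set.OrdConnected.out ‹_› hy hy' ⟨by linarith, by linarith⟩⟩, fun x => ?_⟩
    simp only [Subtype.dist_eq, Real.dist_eq]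
    rcases le_total (x : ℝ) (y + a) with hx | hx
    · refine le_max_of_le_right ?_
      rw [abs_of_nonpos (sub_nonpos.2 hx)]
      linarith [neg_abs_le ((x : ℝ) - y')]
    · refine le_max_of_le_left ?_
      rw [abs_of_nonneg (sub_nonneg.2 hx)]
      linarith [le_abs_self ((x : ℝ) - y)]
  intro y y' a b ha hb hab
  rcases le_total y y' with h | h
  · exact hle y y' a b ha hb hab h
  · obtain ⟨z, hz⟩ := hle y' y b a hb ha (by rw [dist_comm, ← hab, add_comm]) h
    exact ⟨z, hz.symm⟩

namespace Wedge

variable {Z : Type} [MetricSpace Z] {z : Z}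

theorem dist_mk (m n : ℕ) (x y : Z) :
    dist (mk z m x) (mk z n y) = if m = n then dist x y else dist x z + dist z y := by
  rw [mk, mk, SeparationQuotient.dist_mk]
  rfl

theorem dist_mk_same (n : ℕ) (x y : Z) : dist (mk z n x) (mk z n y) = dist x y := by
  rw [dist_mk, if_pos rfl]

theorem dist_mk_of_ne {m n : ℕ} (h : m ≠ n) (x y : Z) :
    dist (mk z m x) (mk z n y) = dist x z + dist z y := by
  rw [dist_mk, if_neg h]

theorem mk_base (m n : ℕ) : mk z m z = mk z n z := by
  rw [← dist_eq_zero, dist_mk, dist_self, add_zero, ite_self]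

theorem dist_mk_base (m n : ℕ) (x : Z) : dist (mk z m x) (mk z n z) = dist x z := by
  rw [mk_base n m, dist_mk_same]

theorem exists_mk (a : Wedge Z z) : ∃ n x, a = mk z n x := by
  obtain ⟨⟨n, x⟩, rfl⟩ := SeparationQuotient.surjective_mk a
  exact ⟨n, x, rfl⟩

theorem isTreeDivision_mk_same {n : ℕ} {y y' w : Z} {a b : ℝ} (h : IsTreeDivision a b y y' w) :
    IsTreeDivision a b (mk z n y) (mk z n y') (mk z n w) := by
  intro x
  obtain ⟨k, x, rfl⟩ := exists_mk x
  by_cases hk : k = n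
  · subst hk
    simpa only [dist_mk_same] using h x
  · simp only [dist_mk_of_ne hk, add_sub_assoc, max_add_add_left]
    exact add_le_add_right (h z) _

theorem exists_isTreeDivision_mk_of_ne (hZ : IsMetricTree Z) {m n : ℕ} (hmn : m ≠ n) {y y' : Z}
    {a b : ℝ} (ha : 0 ≤ a) (hay : a ≤ dist y z) (hab : a + b = dist (mk z m y) (mk z n y')) :
    ∃ w, IsTreeDivision a b (mk z m y) (mk z n y') w := by
  rw [dist_mk_of_ne hmn] at hab
  obtain ⟨w, hw⟩ := hZ y z a (dist y z - a) ha (sub_nonneg.2 hay) (add_sub_cancel _ _)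
  refine ⟨mk z m w, fun x => ?_⟩
  obtain ⟨k, x, rfl⟩ := exists_mk x
  by_cases hk : k = m
  · subst hk
    rw [dist_mk_same, dist_mk_same, dist_mk_of_ne hmn]
    exact (hw x).trans (max_le_max le_rfl (by linarith))
  · refine le_max_of_le_left ?_
    rw [dist_mk_of_ne hk, dist_mk_of_ne hk,
      hw.dist_right ha (sub_nonneg.2 hay) (add_sub_cancel _ _), dist_comm z y]
    linarith

theorem isMetricTree (hZ : IsMetricTree Z) : IsMetricTree (Wedge Z z) := by
  intro x x' a b ha hb hab
  obtain ⟨m, y, rfl⟩ := exists_mk x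
  obtain ⟨n, y', rfl⟩ := exists_mk x'
  by_cases hmn : m = n
  · subst hmn
    rw [dist_mk_same] at hab
    obtain ⟨w, hw⟩ := hZ y y' a b ha hb hab
    exact ⟨mk z m w, isTreeDivision_mk_same hw⟩
  rcases le_total a (dist y z) with hay | hay
  · exact exists_isTreeDivision_mk_of_ne hZ hmn ha hay hab
  · have hby' : b ≤ dist y' z := by
      rw [dist_mk_of_ne hmn, dist_comm z y'] at hab
      linarith
    obtain ⟨w, hw⟩ := exists_isTreeDivision_mk_of_ne hZ (Ne.symm hmn) hb hby'
      (by rw [dist_comm, ← hab, add_comm])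
    exact ⟨w, hw.symm⟩

theorem mem_range_mk {n : ℕ} {x : Wedge Z z} {y : Z} (h : dist x (mk z n y) < dist y z) :
    x ∈ Set.range (mk z n) := by
  obtain ⟨k, x, rfl⟩ := exists_mk x
  by_cases hk : k = n
  · exact ⟨x, by rw [hk]⟩
  · rw [dist_mk_of_ne hk, dist_comm z y] at h
    linarith [dist_nonneg (x := x) (y := z)]

instance [CompleteSpace Z] : CompleteSpace (Wedge Z z) := by
  refine Metric.complete_of_cauchySeq_tendsto fun u hu => ?_
  by_cases hbase : Filter.Tendsto u Filter.atTop (𝓝 (mk z 0 z))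
  · exact ⟨_, hbase⟩
  rw [Metric.tendsto_atTop] at hbase
  push Not at hbase
  obtain ⟨ε, hε, hfar⟩ := hbase
  obtain ⟨N, hN⟩ := Metric.cauchySeq_iff.1 hu ε hε
  obtain ⟨n₀, hn₀, hdist⟩ := hfar N
  obtain ⟨i, y, hy⟩ := exists_mk (u n₀)
  rw [hy, dist_mk_base] at hdist
  have hcopy : ∀ᶠ n in Filter.atTop, u n ∈ Set.range (mk z i) := by
    filter_upwards [Filter.eventually_ge_atTop N] with n hn
    refine mem_range_mk (y := y) ?_
    rw [← hy]
    exact (hN n hn n₀ hn₀).trans_le hdist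
  have hcomplete : IsComplete (Set.range (mk z i)) :=
    (Isometry.of_dist_eq (dist_mk_same i)).isUniformInducing.isComplete_range
  obtain ⟨x, -, hx⟩ := hcomplete _ hu (Filter.le_principal_iff.2 hcopy)
  exact ⟨x, hx⟩

end Wedge

/-! ### Planar division of segments -/

section

variable {t s r a b m A B : ℝ}

/-- In polar coordinates of the Euclidean plane, `(m, a)` is the point
`(1 - t) (s, 0) + t (r, a + b)`. The equation says that both sides have the same component in every
direction `β`. -/
def IsPlanarDivision (t s r a b m : ℝ) : Prop :=
  ∀ β, m * Real.cos (β - a) = (1 - t) * (s * Real.cos β) + t * (r * Real.cos (a + b - β))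

namespace IsPlanarDivision

theorem symm (h : IsPlanarDivision t s r a b m) : IsPlanarDivision (1 - t) r s b a m := fun β => by
  have hβ := h (a + b - β)
  rw [← Real.cos_neg, show -(a + b - β - a) = β - b by ring,
    show a + b - (a + b - β) = β by ring] at hβ
  rw [hβ, add_comm b a]
  ring

theorem sq_eq (h : IsPlanarDivision t s r a b m) :
    m ^ 2 = (1 - t) * s ^ 2 + t * r ^ 2 -
      t * (1 - t) * (s ^ 2 + r ^ 2 - 2 * s * r * Real.cos (a + b)) := by
  have hstart := h 0
  have hmid := h a
  have hend := h (a + b)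
  simp only [zero_sub, Real.cos_neg, Real.cos_zero, sub_zero, sub_self, mul_one,
    add_sub_cancel_left] at hstart hmid hend
  linear_combination m * hmid + (1 - t) * s * hstart + t * r * hend

theorem le_mul_cos_max (h : IsPlanarDivision t s r a b m) (ht : t ∈ Set.Icc (0 : ℝ) 1)
    (hs : 0 ≤ s) (hr : 0 ≤ r) (hA : Real.cos B ≤ Real.cos (a + b - A))
    (hB : Real.cos A ≤ Real.cos (a + b - B)) :
    (1 - t) * (s * Real.cos A) + t * (r * Real.cos B) ≤ m * Real.cos (max (A - a) (B - b)) := by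
  have ht0 := ht.1
  have ht1 := sub_nonneg.2 ht.2
  rcases max_choice (A - a) (B - b) with hmax | hmax
  · rw [hmax, h A]
    gcongr
  · rw [hmax, h.symm B, sub_sub_cancel, add_comm b a, add_comm]
    gcongr

theorem mul_cos_sub_le {K : ℝ} (h : IsPlanarDivision t s r a b m) (ht : t ∈ Set.Icc (0 : ℝ) 1)
    (hr : 0 ≤ r) (hsA : s * Real.cos A ≤ K) (hrB : r * Real.cos B ≤ K)
    (hA : Real.cos (a + b - A) ≤ Real.cos B) : m * Real.cos (A - a) ≤ K := by
  have hrA := (mul_le_mul_of_nonneg_left hA hr).trans hrB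
  rw [h A]
  linarith [mul_le_mul_of_nonneg_left hsA (sub_nonneg.2 ht.2), mul_le_mul_of_nonneg_left hrA ht.1]

theorem mul_cos_max_le {K : ℝ} (h : IsPlanarDivision t s r a b m) (ht : t ∈ Set.Icc (0 : ℝ) 1)
    (hs : 0 ≤ s) (hr : 0 ≤ r) (hsA : s * Real.cos A ≤ K) (hrB : r * Real.cos B ≤ K)
    (hAB : B - b ≤ A - a ∧ Real.cos (a + b - A) ≤ Real.cos B ∨
      A - a ≤ B - b ∧ Real.cos (a + b - B) ≤ Real.cos A) :
    m * Real.cos (max (A - a) (B - b)) ≤ K := by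
  rcases hAB with ⟨hle, hcos⟩ | ⟨hle, hcos⟩
  · rw [max_eq_left hle]
    exact h.mul_cos_sub_le ht hr hsA hrB hcos
  · rw [max_eq_right hle]
    exact h.symm.mul_cos_sub_le ⟨sub_nonneg.2 ht.2, sub_le_self _ ht.1⟩ hs hrB hsA
      (by rwa [add_comm])

theorem mul_cos_dist_sub_le {M : Type*} [MetricSpace M] {y y' z : M} {K : ℝ}
    (h : IsPlanarDivision t s r a b m) (hz : IsTreeDivision a b y y' z)
    (ht : t ∈ Set.Icc (0 : ℝ) 1) (hs : 0 ≤ s) (hr : 0 ≤ r) (ha : 0 ≤ a) (hb : 0 ≤ b)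
    (hab : a + b = dist y y') (x : M) (c : ℝ) (hy : s * Real.cos (dist x y - c) ≤ K)
    (hy' : r * Real.cos (dist x y' - c) ≤ K)
    (hcases : dist x y' + dist y y' = dist x y ∨ dist x y + dist y y' = dist x y' ∨
      Real.cos (dist y y' - (dist x y - c)) ≤ Real.cos (dist x y' - c) ∧
        Real.cos (dist y y' - (dist x y' - c)) ≤ Real.cos (dist x y - c)) :
    m * Real.cos (dist x z - c) ≤ K := by
  rw [hz.dist_eq_max ha hb hab, ← max_sub_sub_right, sub_right_comm, sub_right_comm _ b]
  refine h.mul_cos_max_le ht hs hr hy hy' ?_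
  rw [hab]
  rcases hcases with hmono | hmono | ⟨hA, hB⟩
  · refine Or.inl ⟨by linarith, ?_⟩
    rw [← Real.cos_neg, show -(dist y y' - (dist x y - c)) = dist x y' - c by linarith]
  · refine Or.inr ⟨by linarith, ?_⟩
    rw [← Real.cos_neg, show -(dist y y' - (dist x y' - c)) = dist x y - c by linarith]
  · exact (le_total _ _).imp (⟨·, hA⟩) (⟨·, hB⟩)

end IsPlanarDivision

theorem exists_isPlanarDivision {α : ℝ} (ht : t ∈ Set.Icc (0 : ℝ) 1) (hs : 0 ≤ s) (hr : 0 ≤ r)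
    (hα : α ∈ Set.Icc 0 Real.pi) :
    ∃ m a b, 0 ≤ m ∧ 0 ≤ a ∧ 0 ≤ b ∧ a + b = α ∧ IsPlanarDivision t s r a b m := by
  have ht0 := ht.1
  have ht1 := sub_nonneg.2 ht.2
  rcases hα.1.eq_or_lt with rfl | hpos
  · refine ⟨(1 - t) * s + t * r, 0, 0, by positivity, le_rfl, le_rfl, add_zero 0, fun β => ?_⟩
    rw [sub_zero, add_zero, zero_sub, Real.cos_neg]
    ring
  have hsin : 0 ≤ Real.sin α := Real.sin_nonneg_of_mem_Icc hα
  set ζ : ℂ := ⟨(1 - t) * s + t * (r * Real.cos α), t * (r * Real.sin α)⟩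
  have hre : ‖ζ‖ * Real.cos ζ.arg = (1 - t) * s + t * (r * Real.cos α) :=
    Complex.norm_mul_cos_arg ζ
  have him : ‖ζ‖ * Real.sin ζ.arg = t * (r * Real.sin α) := Complex.norm_mul_sin_arg ζ
  have harg : 0 ≤ ζ.arg := Complex.arg_nonneg_iff.2 (by positivity)
  have hle : ζ.arg ≤ α := by
    by_contra! hlt
    have hζ : ζ ≠ 0 := by
      intro h
      rw [h, Complex.arg_zero] at hlt
      linarith
    have hsin_pos : 0 < ‖ζ‖ * Real.sin (ζ.arg - α) := mul_pos (norm_pos_iff.2 hζ)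
      (Real.sin_pos_of_pos_of_lt_pi (sub_pos.2 hlt) (by linarith [Complex.arg_le_pi ζ]))
    have hsin_eq : ‖ζ‖ * Real.sin (ζ.arg - α) = -((1 - t) * s * Real.sin α) := by
      rw [Real.sin_sub]
      linear_combination Real.cos α * him - Real.sin α * hre
    have hnonneg : 0 ≤ (1 - t) * s * Real.sin α := by positivity
    linarith
  refine ⟨‖ζ‖, ζ.arg, α - ζ.arg, norm_nonneg _, harg, sub_nonneg.2 hle, add_sub_cancel _ _,
    fun β => ?_⟩
  rw [add_sub_cancel, Real.cos_sub, Real.cos_sub]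
  linear_combination Real.cos β * hre + Real.sin β * him

end

/-! ### Euclidean cones -/

theorem cos_le_cos_of_abs_le {u v : ℝ} (hu : u ≤ Real.pi) (h : |v| ≤ u) :
    Real.cos u ≤ Real.cos v := by
  rw [← Real.cos_abs v]
  exact Real.cos_le_cos_of_nonneg_of_le_pi (abs_nonneg v) hu h

theorem cosineSide_arg_nonneg (s t α : ℝ) : 0 ≤ s ^ 2 + t ^ 2 - 2 * s * t * Real.cos α := by
  nlinarith [Real.sin_sq_add_cos_sq α, sq_nonneg (s - t * Real.cos α), sq_nonneg (t * Real.sin α)]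

theorem cosineSide_sq (s t α : ℝ) :
    cosineSide s t α ^ 2 = s ^ 2 + t ^ 2 - 2 * s * t * Real.cos α :=
  Real.sq_sqrt (cosineSide_arg_nonneg s t α)

theorem cosineSide_zero_right (s α : ℝ) : cosineSide s 0 α = |s| := by
  rw [cosineSide, mul_zero, zero_mul, sub_zero, zero_pow two_ne_zero, add_zero, Real.sqrt_sq_eq_abs]

theorem cosineSide_angle_zero (s t : ℝ) : cosineSide s t 0 = |s - t| := by
  rw [cosineSide, Real.cos_zero, mul_one, ← Real.sqrt_sq_eq_abs]
  congr 1
  ring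

theorem cosineSide_angle_pi {s t : ℝ} (hs : 0 ≤ s) (ht : 0 ≤ t) :
    cosineSide s t Real.pi = s + t := by
  rw [cosineSide, Real.cos_pi, ← Real.sqrt_sq (add_nonneg hs ht)]
  congr 1
  ring

theorem cosineSide_le_of_abs_le {s t θ d : ℝ} (hs : 0 ≤ s) (ht : 0 ≤ t) (h : |θ| ≤ d) :
    cosineSide s t θ ≤ cosineSide s t (min d Real.pi) := by
  rcases le_total d Real.pi with hd | hd
  · rw [min_eq_left hd]
    calc cosineSide s t θ = cosineSide s t |θ| := by rw [cosineSide, cosineSide, Real.cos_abs]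
      _ ≤ cosineSide s t d := cosineSide_mono hs ht (abs_nonneg θ) hd h
  · rw [min_eq_right hd]
    refine Real.sqrt_le_sqrt ?_
    rw [Real.cos_pi]
    nlinarith [mul_le_mul_of_nonneg_left (Real.neg_one_le_cos θ) (mul_nonneg hs ht)]

theorem abs_mul_cos_sub_mul_cos_le (s t u v : ℝ) :
    |s * Real.cos u - t * Real.cos v| ≤ cosineSide s t (u - v) := by
  refine Real.abs_le_sqrt ?_
  rw [Real.cos_sub]
  nlinarith [sq_nonneg (s * Real.sin u - t * Real.sin v), Real.sin_sq_add_cos_sq u,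
    Real.sin_sq_add_cos_sq v]

theorem mul_angle_le_cosineSide {c s t θ : ℝ} (hc : 0 ≤ c) (hs : c ≤ s) (ht : c ≤ t)
    (hθ : θ ∈ Set.Icc 0 Real.pi) : 2 * c / Real.pi * θ ≤ cosineSide s t θ := by
  have hcos : 2 / Real.pi ^ 2 * θ ^ 2 ≤ 1 - Real.cos θ := by
    linarith [Real.cos_le_one_sub_mul_cos_sq (abs_le.2 ⟨by linarith [hθ.1, Real.pi_pos], hθ.2⟩)]
  refine Real.le_sqrt_of_sq_le ?_
  calc (2 * c / Real.pi * θ) ^ 2 = 2 * (c * c) * (2 / Real.pi ^ 2 * θ ^ 2) := by ring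
    _ ≤ 2 * (s * t) * (1 - Real.cos θ) := by
        have hs0 := hc.trans hs
        have ht0 := hc.trans ht
        gcongr
    _ ≤ s ^ 2 + t ^ 2 - 2 * s * t * Real.cos θ := by linarith [sq_nonneg (s - t)]

theorem cosineSide_of_mul_cos_eq {r s u v : ℝ} (hs : 0 ≤ s) (hu : -(Real.pi / 2) < u) (huv : u ≤ v)
    (hv : v < Real.pi / 2) (h : r * Real.cos u = s * Real.cos v) :
    cosineSide r s (v - u) = s * Real.sin v - r * Real.sin u := by
  have hcos : 0 < Real.cos u := Real.cos_pos_of_mem_Ioo ⟨hu, huv.trans_lt hv⟩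
  have hsin : 0 ≤ Real.sin (v - u) :=
    Real.sin_nonneg_of_nonneg_of_le_pi (sub_nonneg.2 huv) (by linarith)
  have hnonneg : 0 ≤ s * Real.sin v - r * Real.sin u := by
    refine nonneg_of_mul_nonneg_left ?_ hcos
    calc 0 ≤ s * Real.sin (v - u) := mul_nonneg hs hsin
      _ = (s * Real.sin v - r * Real.sin u) * Real.cos u := by
        rw [Real.sin_sub]
        linear_combination Real.sin u * h
  rw [cosineSide, ← Real.sqrt_sq hnonneg, Real.cos_sub]
  congr 1
  linear_combination (r * Real.cos u - s * Real.cos v) * h - r ^ 2 * Real.sin_sq_add_cos_sq u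
    - s ^ 2 * Real.sin_sq_add_cos_sq v

namespace EuclCone

variable {Y : Type} [MetricSpace Y]

theorem exists_ray (z : EuclCone Y) : ∃ s y, z = ray s y := by
  obtain ⟨⟨s, y⟩, rfl⟩ := SeparationQuotient.surjective_mk z
  exact ⟨s, y, rfl⟩

theorem dist_ray (s t : ℝ≥0) (x y : Y) :
    dist (ray s x) (ray t y) = cosineSide s t (min (dist x y) Real.pi) := by
  rw [ray, ray, SeparationQuotient.dist_mk]
  rfl

theorem dist_ray_of_le_pi {x y : Y} (h : dist x y ≤ Real.pi) (s t : ℝ≥0) :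
    dist (ray s x) (ray t y) = cosineSide s t (dist x y) := by
  rw [dist_ray, min_eq_left h]

theorem dist_ray_sq {x y : Y} (h : dist x y ≤ Real.pi) (s t : ℝ≥0) :
    dist (ray s x) (ray t y) ^ 2 =
      (s : ℝ) ^ 2 + (t : ℝ) ^ 2 - 2 * s * t * Real.cos (dist x y) := by
  rw [dist_ray_of_le_pi h, cosineSide_sq]

theorem dist_ray_zero (s : ℝ≥0) (x y : Y) : dist (ray s x) (ray 0 y) = s := by
  rw [dist_ray, NNReal.coe_zero, cosineSide_zero_right, abs_of_nonneg s.coe_nonneg]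

theorem dist_ray_same (s t : ℝ≥0) (y : Y) : dist (ray s y) (ray t y) = |(s : ℝ) - t| := by
  rw [dist_ray, dist_self, min_eq_left Real.pi_pos.le, cosineSide_angle_zero]

theorem ray_zero (x y : Y) : ray 0 x = ray 0 y := by
  rw [← dist_eq_zero, dist_ray_zero, NNReal.coe_zero]

theorem dist_rad_le (s t : ℝ≥0) (x y : Y) : dist s t ≤ dist (ray s x) (ray t y) := by
  rw [NNReal.dist_eq, ← dist_ray_zero s x x, ← dist_ray_zero t y x]
  exact abs_dist_sub_le _ _ _

theorem metricBetween_ray {r s t : ℝ≥0} (hrs : r ≤ s) (hst : s ≤ t) (y : Y) :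
    MetricBetween (ray r y) (ray s y) (ray t y) := by
  have hrs' : (r : ℝ) - s ≤ 0 := sub_nonpos.2 hrs
  have hst' : (s : ℝ) - t ≤ 0 := sub_nonpos.2 hst
  rw [MetricBetween, dist_ray_same, dist_ray_same, dist_ray_same, abs_of_nonpos hrs',
    abs_of_nonpos hst', abs_of_nonpos (by linarith)]
  ring

theorem metricBetween_ray_zero {x y z : Y} (h : Real.pi ≤ dist x z) (r t : ℝ≥0) :
    MetricBetween (ray r x) (ray 0 y) (ray t z) := by
  rw [MetricBetween, dist_comm (ray 0 y), dist_ray_zero, dist_ray_zero, dist_ray, min_eq_right h,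
    cosineSide_angle_pi r.coe_nonneg t.coe_nonneg]

theorem metricBetween_of_mul_cos_eq {x y z : Y} {r s t : ℝ≥0} {u v w : ℝ}
    (hu : -(Real.pi / 2) < u) (huv : u ≤ v) (hvw : v ≤ w) (hw : w < Real.pi / 2)
    (hrs : r * Real.cos u = s * Real.cos v) (hst : s * Real.cos v = t * Real.cos w)
    (hxy : dist x y = v - u) (hyz : dist y z = w - v) (hxz : dist x z = w - u) :
    MetricBetween (ray r x) (ray s y) (ray t z) := by
  rw [MetricBetween, dist_ray_of_le_pi (by linarith), dist_ray_of_le_pi (by linarith),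
    dist_ray_of_le_pi (by linarith), hxy, hyz, hxz,
    cosineSide_of_mul_cos_eq s.coe_nonneg hu huv (hvw.trans_lt hw) hrs,
    cosineSide_of_mul_cos_eq t.coe_nonneg (hu.trans_le huv) hvw hw hst,
    cosineSide_of_mul_cos_eq t.coe_nonneg hu (huv.trans hvw) hw (hrs.trans hst)]
  ring

theorem metricBetween_ray_of_right_angle {s t : ℝ≥0} {x y z : Y}
    (hst : (t : ℝ) = s * Real.cos (Real.pi / 4)) (hxy : dist x y = Real.pi / 4)
    (hyz : dist y z = Real.pi / 4) (hbtw : MetricBetween x y z) :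
    MetricBetween (ray s x) (ray t y) (ray s z) := by
  have hpi := Real.pi_pos
  refine metricBetween_of_mul_cos_eq (u := -(Real.pi / 4)) (v := 0) (w := Real.pi / 4)
    (by linarith) (by linarith) (by linarith) (by linarith) ?_ ?_ ?_ ?_ ?_
  · rw [Real.cos_neg, Real.cos_zero, mul_one, hst]
  · rw [Real.cos_zero, mul_one, hst]
  · rw [hxy]
    ring
  · rw [hyz]
    ring
  · rw [← hbtw, hxy, hyz]
    ring

theorem dist_sq_add_dist_sq_le {v w y : Y} {σ τ s : ℝ≥0} (hτ : τ = σ * Real.cos (dist v w))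
    (hw : dist v w + dist w y = dist v y) (hπ : dist v y ≤ Real.pi) :
    dist (ray σ v) (ray τ w) ^ 2 + dist (ray τ w) (ray s y) ^ 2 ≤
      dist (ray σ v) (ray s y) ^ 2 := by
  have hvw : 0 ≤ dist v w := dist_nonneg
  have hwy : 0 ≤ dist w y := dist_nonneg
  have hsin : 0 ≤ Real.sin (dist v w) * Real.sin (dist w y) :=
    mul_nonneg (Real.sin_nonneg_of_nonneg_of_le_pi hvw (by linarith))
      (Real.sin_nonneg_of_nonneg_of_le_pi hwy (by linarith))
  have hsσ : 0 ≤ (s : ℝ) * σ := by positivity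
  rw [dist_ray_sq (by linarith), dist_ray_sq (by linarith), dist_ray_sq hπ, ← hw, hτ, Real.cos_add]
  linarith [mul_nonneg hsσ hsin]

theorem continuous_ray : Continuous fun q : ℝ≥0 × Y => ray q.1 q.2 := by
  refine continuous_iff_continuousAt.2 fun q₀ => tendsto_iff_dist_tendsto_zero.2 ?_
  have hcont : Continuous fun q : ℝ≥0 × Y => dist (ray q.1 q.2) (ray q₀.1 q₀.2) := by
    simp only [dist_ray, cosineSide]
    fun_prop
  simpa only [dist_self] using hcont.tendsto q₀

theorem cauchySeq_rad {s : ℕ → ℝ≥0} {y : ℕ → Y} (h : CauchySeq fun n => ray (s n) (y n)) :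
    CauchySeq s := by
  rw [Metric.cauchySeq_iff] at h ⊢
  intro ε hε
  obtain ⟨N, hN⟩ := h ε hε
  exact ⟨N, fun m hm n hn => (dist_rad_le _ _ _ _).trans_lt (hN m hm n hn)⟩

theorem cauchySeq_dir {s : ℕ → ℝ≥0} {y : ℕ → Y} (h : CauchySeq fun n => ray (s n) (y n))
    {c : ℝ≥0} (hc : 0 < c) (hs : ∀ᶠ n in Filter.atTop, c ≤ s n) : CauchySeq y := by
  rw [Metric.cauchySeq_iff] at h ⊢
  intro ε hε
  have hslope : 0 < 2 * (c : ℝ) / Real.pi := by positivity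
  obtain ⟨N, hN⟩ := h (2 * c / Real.pi * min ε Real.pi)
    (mul_pos hslope (lt_min hε Real.pi_pos))
  obtain ⟨N', hN'⟩ := Filter.eventually_atTop.1 hs
  refine ⟨max N N', fun m hm n hn => ?_⟩
  have hlt := hN m (le_of_max_le_left hm) n (le_of_max_le_left hn)
  rw [dist_ray] at hlt
  have hmin : min (dist (y m) (y n)) Real.pi < min ε Real.pi :=
    lt_of_mul_lt_mul_left ((mul_angle_le_cosineSide c.coe_nonneg
      (NNReal.coe_le_coe.2 (hN' m (le_of_max_le_right hm)))
      (NNReal.coe_le_coe.2 (hN' n (le_of_max_le_right hn)))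
      ⟨le_min dist_nonneg Real.pi_pos.le, min_le_right _ _⟩).trans_lt hlt) hslope.le
  exact (lt_min_iff.1 ((min_lt_iff.1 hmin).resolve_right
    fun h => (h.trans_le (min_le_right _ _)).false)).1

instance [CompleteSpace Y] : CompleteSpace (EuclCone Y) := by
  refine Metric.complete_of_cauchySeq_tendsto fun u hu => ?_
  choose s y hsy using fun n => exists_ray (u n)
  obtain rfl : u = fun n => ray (s n) (y n) := funext hsy
  obtain ⟨s', hs'⟩ := cauchySeq_tendsto_of_complete (cauchySeq_rad hu)
  rcases eq_zero_or_pos s' with rfl | hpos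
  · refine ⟨ray 0 (y 0), tendsto_iff_dist_tendsto_zero.2 ?_⟩
    simp only [dist_ray_zero]
    exact NNReal.tendsto_coe.2 hs'
  · have hlarge : ∀ᶠ n in Filter.atTop, s' / 2 ≤ s n :=
      hs'.eventually (le_mem_nhds (NNReal.half_lt_self hpos.ne'))
    obtain ⟨y', hy'⟩ := cauchySeq_tendsto_of_complete (cauchySeq_dir hu (half_pos hpos) hlarge)
    exact ⟨ray s' y', (continuous_ray.tendsto (s', y')).comp (hs'.prodMk_nhds hy')⟩

theorem isBarycentre_ray (hY : ∀ x y : Y, dist x y ≤ Real.pi) {s r m : ℝ≥0} {t a b : ℝ}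
    {y y' z : Y} (ht : t ∈ Set.Icc (0 : ℝ) 1) (ha : 0 ≤ a) (hb : 0 ≤ b) (hab : a + b = dist y y')
    (hm : IsPlanarDivision t s r a b m) (hz : IsTreeDivision a b y y' z) :
    IsBarycentre t (ray s y) (ray r y') (ray m z) := by
  intro x
  obtain ⟨σ, x, rfl⟩ := exists_ray x
  have htriangle : ∀ u v w : Y, Real.cos (dist u w) ≤ Real.cos (dist v w - dist u v) := by
    intro u v w
    refine cos_le_cos_of_abs_le (hY u w) ?_
    rw [dist_comm v w, dist_comm u w]
    exact abs_dist_sub_le w u v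
  have hmain : (1 - t) * (s * Real.cos (dist x y)) + t * (r * Real.cos (dist x y')) ≤
      m * Real.cos (dist x z) := by
    refine (hm.le_mul_cos_max ht s.coe_nonneg r.coe_nonneg (hab ▸ htriangle x y y')
      (by rw [hab, dist_comm y]; exact htriangle x y' y)).trans ?_
    exact mul_le_mul_of_nonneg_left (Real.cos_le_cos_of_nonneg_of_le_pi dist_nonneg
      (max_le (by linarith [hY x y]) (by linarith [hY x y'])) (hz x)) m.coe_nonneg
  rw [dist_ray_sq (hY _ _), dist_ray_sq (hY _ _), dist_ray_sq (hY _ _), dist_ray_sq (hY _ _),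
    hm.sq_eq, ← hab]
  linarith [mul_le_mul_of_nonneg_left hmain σ.coe_nonneg]

theorem hasBarycentres (hY : ∀ x y : Y, dist x y ≤ Real.pi) (htree : IsMetricTree Y) :
    HasBarycentres (EuclCone Y) := by
  intro q q' t ht
  obtain ⟨s, y, rfl⟩ := exists_ray q
  obtain ⟨r, y', rfl⟩ := exists_ray q'
  obtain ⟨m, a, b, hm, ha, hb, hab, hplanar⟩ :=
    exists_isPlanarDivision ht s.coe_nonneg r.coe_nonneg ⟨dist_nonneg, hY y y'⟩
  obtain ⟨z, hz⟩ := htree y y' a b ha hb hab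
  lift m to ℝ≥0 using hm
  exact ⟨ray m z, isBarycentre_ray hY ht ha hb hab hplanar hz⟩

theorem exists_ray_of_metricBetween (hY : ∀ x y : Y, dist x y ≤ Real.pi) (htree : IsMetricTree Y)
    {s r : ℝ≥0} {y y' : Y} {q : EuclCone Y} (hq : MetricBetween (ray s y) q (ray r y')) (x : Y) :
    ∃ m z, q = ray m z ∧ dist x y + dist x y' ≤ dist y y' + 2 * dist x z ∧
      ∀ c K : ℝ, s * Real.cos (dist x y - c) ≤ K → r * Real.cos (dist x y' - c) ≤ K →
        (dist x y' + dist y y' = dist x y ∨ dist x y + dist y y' = dist x y' ∨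
          Real.cos (dist y y' - (dist x y - c)) ≤ Real.cos (dist x y' - c) ∧
            Real.cos (dist y y' - (dist x y' - c)) ≤ Real.cos (dist x y - c)) →
        m * Real.cos (dist x z - c) ≤ K := by
  obtain ⟨t, ht, hyq, hqy'⟩ := hq.exists_ratio
  obtain ⟨m, a, b, hm, ha, hb, hab, hplanar⟩ :=
    exists_isPlanarDivision ht s.coe_nonneg r.coe_nonneg ⟨dist_nonneg, hY y y'⟩
  obtain ⟨z, hz⟩ := htree y y' a b ha hb hab
  lift m to ℝ≥0 using hm
  refine ⟨m, z, (isBarycentre_ray hY ht ha hb hab hplanar hz).eq_of_dist hyq hqy', ?_, fun c K =>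
    hplanar.mul_cos_dist_sub_le hz ht s.coe_nonneg r.coe_nonneg ha hb hab x c⟩
  linarith [hz.dist_eq_max ha hb hab x, le_max_left (dist x y - a) (dist x y' - b),
    le_max_right (dist x y - a) (dist x y' - b)]

theorem abs_mul_cos_sub_le_dist {f : Y → ℝ} (hf : LipschitzWith 1 f) (s t : ℝ≥0) (x y : Y) :
    |s * Real.cos (f x) - t * Real.cos (f y)| ≤ dist (ray s x) (ray t y) := by
  rw [dist_ray]
  refine (abs_mul_cos_sub_mul_cos_le _ _ _ _).trans
    (cosineSide_le_of_abs_le s.coe_nonneg t.coe_nonneg ?_)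
  rw [← Real.dist_eq]
  simpa only [NNReal.coe_one, one_mul] using hf.dist_le_mul x y

/-- The function `s · y ↦ s cos (f y)` on the cone. For a `1`-Lipschitz `f` it is `1`-Lipschitz and
takes the same value at all pairs representing the tip; when `f` is the signed distance to a point
of a geodesic, it is the orthogonal projection to the ray in the direction of this point. -/
noncomputable def cosProj (f : Y → ℝ) (hf : LipschitzWith 1 f) : EuclCone Y → ℝ :=
  SeparationQuotient.lift (fun a : PreCone Y => (a.rad : ℝ) * Real.cos (f a.dir)) fun a b hab => by
    have h := abs_mul_cos_sub_le_dist hf a.rad b.rad a.dir b.dir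
    rw [ray, ray, SeparationQuotient.mk_eq_mk.2 hab, dist_self] at h
    exact sub_eq_zero.1 (abs_nonpos_iff.1 h)

theorem cosProj_ray (f : Y → ℝ) (hf : LipschitzWith 1 f) (s : ℝ≥0) (y : Y) :
    cosProj f hf (ray s y) = s * Real.cos (f y) :=
  rfl

theorem lipschitzWith_cosProj (f : Y → ℝ) (hf : LipschitzWith 1 f) :
    LipschitzWith 1 (cosProj f hf) := by
  refine LipschitzWith.of_dist_le_mul fun q q' => ?_
  obtain ⟨s, x, rfl⟩ := exists_ray q
  obtain ⟨t, y, rfl⟩ := exists_ray q'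
  rw [NNReal.coe_one, one_mul, Real.dist_eq]
  exact abs_mul_cos_sub_le_dist hf s t x y

end EuclCone

/-! ### The tree -/

namespace Example

/-- The point at distance `x` from `b n` on the edge from `b n` to `e n k`. -/
noncomputable def pt (n k : ℕ) (x : Edge) : Y :=
  Wedge.mk (endpt 0) n (Wedge.mk edgeStart k x)

theorem exists_pt (y : Y) : ∃ n k x, y = pt n k x := by
  obtain ⟨n, y, rfl⟩ := Wedge.exists_mk y
  obtain ⟨k, x, rfl⟩ := Wedge.exists_mk y
  exact ⟨n, k, x, rfl⟩

theorem e_eq_pt (n k : ℕ) : e n k = pt n k edgeEnd :=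
  rfl

theorem b_eq_pt (n k : ℕ) : b n = pt n k edgeStart := by
  rw [b, centre, Wedge.mk_base 0 k, pt]

theorem e_zero (n : ℕ) : e n 0 = p :=
  Wedge.mk_base n 0

theorem dist_pt_same (n k : ℕ) (x y : Edge) : dist (pt n k x) (pt n k y) = |(x : ℝ) - y| := by
  rw [pt, pt, Wedge.dist_mk_same, Wedge.dist_mk_same]
  rfl

theorem dist_b_pt (n k : ℕ) (x : Edge) : dist (b n) (pt n k x) = x := by
  rw [b_eq_pt n k, dist_pt_same, abs_sub_comm, edgeStart, sub_zero, abs_of_nonneg x.2.1]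

theorem dist_b_e (n k : ℕ) : dist (b n) (e n k) = Real.pi / 4 :=
  dist_b_pt n k edgeEnd

theorem dist_pt_e (n k : ℕ) (x : Edge) : dist (pt n k x) (e n k) = Real.pi / 4 - x := by
  rw [e_eq_pt, dist_pt_same, abs_sub_comm, edgeEnd, abs_of_nonneg (sub_nonneg.2 x.2.2)]

theorem metricBetween_b (n : ℕ) {k l : ℕ} (h : k ≠ l) (x y : Edge) :
    MetricBetween (pt n k x) (b n) (pt n l y) := by
  rw [MetricBetween, b, centre, pt, pt, Wedge.dist_mk_same, Wedge.dist_mk_same, Wedge.dist_mk_same,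
    Wedge.dist_mk_of_ne h, Wedge.dist_mk_base, dist_comm (Wedge.mk _ 0 _), Wedge.dist_mk_base,
    dist_comm y]

theorem metricBetween_p {m n : ℕ} (h : m ≠ n) (k l : ℕ) (x y : Edge) :
    MetricBetween (pt m k x) p (pt n l y) := by
  rw [MetricBetween, p, pt, pt, Wedge.dist_mk_of_ne h, Wedge.dist_mk_base,
    dist_comm (Wedge.mk _ 0 _), Wedge.dist_mk_base, dist_comm (Wedge.mk _ l y)]

theorem dist_p_pt_zero (n : ℕ) (x : Edge) : dist p (pt n 0 x) = Real.pi / 4 - x := by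
  rw [← e_zero n, dist_comm, dist_pt_e]

theorem dist_p_pt (n : ℕ) {k : ℕ} (hk : k ≠ 0) (x : Edge) :
    dist p (pt n k x) = Real.pi / 4 + x := by
  rw [← e_zero n, e_eq_pt, ← metricBetween_b n hk.symm, dist_comm _ (b n), dist_b_pt, dist_b_pt]
  rfl

theorem dist_p_b (n : ℕ) : dist p (b n) = Real.pi / 4 := by
  rw [← e_zero n, dist_comm, dist_b_e]

theorem dist_p_e (n : ℕ) {k : ℕ} (hk : k ≠ 0) : dist p (e n k) = Real.pi / 2 := by
  rw [e_eq_pt, dist_p_pt n hk, edgeEnd]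
  ring

theorem dist_p_le (y : Y) : dist p y ≤ Real.pi / 2 := by
  obtain ⟨n, k, x, rfl⟩ := exists_pt y
  rcases eq_or_ne k 0 with rfl | hk
  · rw [dist_p_pt_zero]
    linarith [x.2.1, Real.pi_pos]
  · rw [dist_p_pt n hk]
    linarith [x.2.2]

theorem dist_le_pi (x y : Y) : dist x y ≤ Real.pi := by
  linarith [dist_p_le x, dist_p_le y, dist_triangle_left x y p]

theorem isMetricTree_Y : IsMetricTree Y :=
  Wedge.isMetricTree (Wedge.isMetricTree (isMetricTree_of_ordConnected _))

theorem hasBarycentres_cone : HasBarycentres (EuclCone Y) :=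
  EuclCone.hasBarycentres dist_le_pi isMetricTree_Y

/-- The segment between two points of `Y` is monotone with respect to the distance from `p`, or
it turns around at `p`, or it turns around at one of the points of `B`. -/
theorem dist_cases (y y' : Y) :
    dist p y' + dist y y' = dist p y ∨ dist p y + dist y y' = dist p y' ∨
      dist y y' = dist p y + dist p y' ∨ dist y y' + Real.pi / 2 = dist p y + dist p y' := by
  obtain ⟨n, k, x, rfl⟩ := exists_pt y
  obtain ⟨m, l, x', rfl⟩ := exists_pt y'
  rcases ne_or_eq n m with hnm | rfl
  · right; right; left
    rw [← metricBetween_p hnm, dist_comm _ p]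
  rcases ne_or_eq k l with hkl | rfl
  · rw [← metricBetween_b n hkl, dist_comm _ (b n), dist_b_pt, dist_b_pt]
    rcases eq_or_ne k 0 with rfl | hk
    · right; left
      rw [dist_p_pt_zero, dist_p_pt n hkl.symm]
      ring
    rcases eq_or_ne l 0 with rfl | hl
    · left
      rw [dist_p_pt_zero, dist_p_pt n hk]
      ring
    · right; right; right
      rw [dist_p_pt n hk, dist_p_pt n hl]
      ring
  · have hdist : dist p (pt n k x) - dist p (pt n k x') = dist (pt n k x) (pt n k x') ∨
        dist p (pt n k x) - dist p (pt n k x') = -dist (pt n k x) (pt n k x') := by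
      rw [dist_pt_same, ← abs_eq_abs, abs_abs]
      rcases eq_or_ne k 0 with rfl | hk
      · rw [dist_p_pt_zero, dist_p_pt_zero, sub_sub_sub_cancel_left, abs_sub_comm]
      · rw [dist_p_pt n hk, dist_p_pt n hk, add_sub_add_left_eq_sub]
    rcases hdist with hdist | hdist
    · left
      linarith
    · right; left
      linarith

/-! ### The set `X` as a convex region of the cone -/

/-- The orthogonal projection to the ray in the direction of the point at distance `c` from `p`,
on the cone over a segment of `Y` that starts at `p`. -/
noncomputable def axisProj (c : ℝ) : EuclCone Y → ℝ :=
  EuclCone.cosProj (fun y => dist p y - c) <| LipschitzWith.of_dist_le_mul fun y y' => by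
    rw [dist_sub_right, NNReal.coe_one, one_mul, dist_comm p, dist_comm p]
    exact dist_dist_dist_le_left y y' p

theorem axisProj_ray (c : ℝ) (s : ℝ≥0) (y : Y) :
    axisProj c (EuclCone.ray s y) = s * Real.cos (dist p y - c) :=
  EuclCone.cosProj_ray _ _ s y

/-- The points below the chord from `2 · y` to `2 · y'` for every edge from `y` to `y'`. The two
inequalities express this for the edges at `p`, with midpoints at distance `π/8` from `p`, and the
edges at the endpoints, with midpoints at distance `3π/8`; the other inequality is then
automatic. -/
def region : Set (EuclCone Y) :=
  {z | axisProj (Real.pi / 8) z ≤ 2 * Real.cos (Real.pi / 8) ∧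
    axisProj (3 * Real.pi / 8) z ≤ 2 * Real.cos (Real.pi / 8)}

theorem isClosed_region : IsClosed region :=
  (isClosed_le (EuclCone.lipschitzWith_cosProj _ _).continuous continuous_const).inter
    (isClosed_le (EuclCone.lipschitzWith_cosProj _ _).continuous continuous_const)

theorem cos_sub_le_of_turn {g A B c α : ℝ} (hturn : α + 2 * g = A + B) (hA : g ≤ A) (hB : g ≤ B)
    (hc : g ≤ c) (hAc : A + c ≤ Real.pi + 2 * g) (hBc : B + c ≤ Real.pi + 2 * g) :
    Real.cos (α - (A - c)) ≤ Real.cos (B - c) ∧ Real.cos (α - (B - c)) ≤ Real.cos (A - c) :=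
  ⟨cos_le_cos_of_abs_le (by linarith) (abs_le.2 ⟨by linarith, by linarith⟩),
    cos_le_cos_of_abs_le (by linarith) (abs_le.2 ⟨by linarith, by linarith⟩)⟩

theorem isGeodConvex_region : IsGeodConvex region := by
  intro q hq q' hq' m hm
  obtain ⟨s, y, rfl⟩ := EuclCone.exists_ray q
  obtain ⟨r, y', rfl⟩ := EuclCone.exists_ray q'
  obtain ⟨σ, z, rfl, hpz, hproj⟩ :=
    EuclCone.exists_ray_of_metricBetween dist_le_pi isMetricTree_Y hm p
  have hy := dist_p_le y
  have hy' := dist_p_le y'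
  have hpi := Real.pi_pos
  rcases dist_cases y y' with hmono | hmono | hturn | hturn
  · exact ⟨hproj _ _ hq.1 hq'.1 (Or.inl hmono), hproj _ _ hq.2 hq'.2 (Or.inl hmono)⟩
  · exact ⟨hproj _ _ hq.1 hq'.1 (Or.inr (Or.inl hmono)),
      hproj _ _ hq.2 hq'.2 (Or.inr (Or.inl hmono))⟩
  · have hcos (c : ℝ) (hc : 0 ≤ c) (hc' : c ≤ Real.pi / 2) :=
      cos_sub_le_of_turn (g := 0) (A := dist p y) (B := dist p y') (α := dist y y')
        (by rw [hturn]; ring) dist_nonneg dist_nonneg hc (by linarith) (by linarith)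
    exact ⟨hproj _ _ hq.1 hq'.1 (Or.inr (Or.inr (hcos _ (by linarith) (by linarith)))),
      hproj _ _ hq.2 hq'.2 (Or.inr (Or.inr (hcos _ (by linarith) (by linarith))))⟩
  · have hyy' := dist_triangle p y y'
    have hy'y := dist_triangle_right p y y'
    have hfar : σ * Real.cos (dist p z - 3 * Real.pi / 8) ≤ 2 * Real.cos (Real.pi / 8) :=
      hproj _ _ hq.2 hq'.2 (Or.inr (Or.inr (cos_sub_le_of_turn (g := Real.pi / 4) (A := dist p y)
        (B := dist p y') (by linarith) (by linarith) (by linarith) (by linarith) (by linarith)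
        (by linarith))))
    have hnear : Real.cos (dist p z - Real.pi / 8) ≤ Real.cos (dist p z - 3 * Real.pi / 8) :=
      cos_le_cos_of_abs_le (by linarith [dist_p_le z]) (abs_le.2 ⟨by linarith, by linarith⟩)
    exact ⟨(mul_le_mul_of_nonneg_left hnear σ.coe_nonneg).trans hfar, hfar⟩

theorem ray_mem_region_of_le_one {s : ℝ≥0} (hs : s ≤ 1) (y : Y) : EuclCone.ray s y ∈ region := by
  have hcos : 1 / 2 ≤ Real.cos (Real.pi / 8) := by
    rw [← Real.cos_pi_div_three]
    refine cos_le_cos_of_abs_le ?_ (abs_le.2 ⟨?_, ?_⟩) <;> linarith [Real.pi_pos]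
  have hproj : ∀ c, s * Real.cos c ≤ 2 * Real.cos (Real.pi / 8) := fun c =>
    calc s * Real.cos c ≤ 1 * 1 :=
          mul_le_mul_of_nonneg hs (Real.cos_le_one c) s.coe_nonneg zero_le_one
      _ ≤ 2 * Real.cos (Real.pi / 8) := by linarith
  exact ⟨hproj _, hproj _⟩

theorem ray_two_mem_region {y : Y}
    (hy : dist p y = 0 ∨ dist p y = Real.pi / 4 ∨ dist p y = Real.pi / 2) :
    EuclCone.ray 2 y ∈ region := by
  have hpi := Real.pi_pos
  have hcos : ∀ c, Real.pi / 8 ≤ c → c ≤ Real.pi →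
      ((2 : ℝ≥0) : ℝ) * Real.cos c ≤ 2 * Real.cos (Real.pi / 8) := fun c hc hc' =>
    mul_le_mul_of_nonneg_left
      (cos_le_cos_of_abs_le hc' (abs_le.2 ⟨by linarith, by linarith⟩)) zero_le_two
  have hcos_neg : ∀ c, Real.pi / 8 ≤ -c → -c ≤ Real.pi →
      ((2 : ℝ≥0) : ℝ) * Real.cos c ≤ 2 * Real.cos (Real.pi / 8) := fun c hc hc' => by
    rw [← Real.cos_neg]
    exact hcos (-c) hc hc'
  simp only [region, Set.mem_ofPred_eq, axisProj_ray]
  rcases hy with hy | hy | hy <;> rw [hy]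
  · exact ⟨hcos_neg _ (by linarith) (by linarith), hcos_neg _ (by linarith) (by linarith)⟩
  · exact ⟨hcos _ (by linarith) (by linarith), hcos_neg _ (by linarith) (by linarith)⟩
  · exact ⟨hcos _ (by linarith) (by linarith), hcos _ (by linarith) (by linarith)⟩

theorem triangle_subset_region (n k : ℕ) : triangle (b n) (e n k) ⊆ region := by
  rintro z ⟨w, hw, hz⟩
  have he : EuclCone.ray 2 (e n k) ∈ region := by
    rcases eq_or_ne k 0 with rfl | hk
    · exact ray_two_mem_region (Or.inl (by rw [e_zero, dist_self]))
    · exact ray_two_mem_region (Or.inr (Or.inr (dist_p_e n hk)))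
  exact isGeodConvex_region _ (ray_mem_region_of_le_one zero_le_one p) _
    (isGeodConvex_region _ (ray_two_mem_region (Or.inr (Or.inl (dist_p_b n)))) _ he _ hw) _ hz

theorem ray_pt_mem_triangle {s : ℝ≥0} {n k : ℕ} {x : Edge}
    (hs : s * Real.cos (x - Real.pi / 8) ≤ 2 * Real.cos (Real.pi / 8)) :
    EuclCone.ray s (pt n k x) ∈ triangle (b n) (e n k) := by
  have hpi := Real.pi_pos
  have hx0 := x.2.1
  have hx1 := x.2.2
  have hcos : 0 < Real.cos (x - Real.pi / 8) :=
    Real.cos_pos_of_mem_Ioo ⟨by linarith, by linarith⟩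
  have hcos' : 0 < Real.cos (Real.pi / 8) :=
    Real.cos_pos_of_mem_Ioo ⟨by linarith, by linarith⟩
  obtain ⟨ρ, hρ⟩ : ∃ ρ : ℝ≥0, ρ * Real.cos (x - Real.pi / 8) = 2 * Real.cos (Real.pi / 8) :=
    ⟨⟨2 * Real.cos (Real.pi / 8) / Real.cos (x - Real.pi / 8), by positivity⟩,
      div_mul_cancel₀ _ hcos.ne'⟩
  refine ⟨EuclCone.ray ρ (pt n k x), ?_, ?_⟩
  · refine EuclCone.metricBetween_of_mul_cos_eq (u := -(Real.pi / 8)) (v := x - Real.pi / 8)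
      (w := Real.pi / 8) (by linarith) (by linarith) (by linarith) (by linarith)
      (by rw [hρ, Real.cos_neg]; rfl) hρ ?_ ?_ ?_
    · rw [dist_b_pt]
      ring
    · rw [dist_pt_e]
      ring
    · rw [dist_b_e]
      ring
  · rw [o, EuclCone.ray_zero p (pt n k x)]
    exact EuclCone.metricBetween_ray zero_le
      (NNReal.coe_le_coe.1 (le_of_mul_le_mul_right (hs.trans_eq hρ.symm) hcos)) _

theorem X_eq_region : X = region := by
  refine (Set.iUnion₂_subset triangle_subset_region).antisymm fun z hz => ?_
  obtain ⟨s, y, rfl⟩ := EuclCone.exists_ray z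
  obtain ⟨n, k, x, rfl⟩ := exists_pt y
  refine Set.mem_iUnion₂.2 ⟨n, k, ray_pt_mem_triangle ?_⟩
  simp only [region, Set.mem_ofPred_eq, axisProj_ray] at hz
  rcases eq_or_ne k 0 with rfl | hk
  · rw [dist_p_pt_zero, ← Real.cos_neg] at hz
    convert hz.1 using 3
    ring
  · rw [dist_p_pt n hk] at hz
    convert hz.2 using 3
    ring

theorem hasBarycentres_X : HasBarycentres X :=
  hasBarycentres_cone.of_isGeodConvex (X_eq_region ▸ isGeodConvex_region)

instance : CompleteSpace X :=
  IsClosed.completeSpace_coe (hs := X_eq_region ▸ isClosed_region)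

theorem ray_mem_X {s : ℝ≥0} (hs : s ≤ 1) (y : Y) : EuclCone.ray s y ∈ X :=
  X_eq_region ▸ ray_mem_region_of_le_one hs y

theorem X_subset_closedBall : X ⊆ Metric.closedBall o 6 := by
  refine Set.iUnion₂_subset fun n k => ?_
  rintro z ⟨w, hw, hz⟩
  rw [MetricBetween] at hw hz
  have hrad : ∀ y, dist o (EuclCone.ray 2 y) = 2 := fun y => by
    rw [dist_comm]
    exact EuclCone.dist_ray_zero 2 _ _
  rw [Metric.mem_closedBall, dist_comm]
  linarith [hrad (b n), hrad (e n k), dist_nonneg (x := z) (y := w),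
    dist_nonneg (x := w) (y := EuclCone.ray 2 (e n k)), dist_triangle o (EuclCone.ray 2 (b n)) w,
    dist_triangle_left (EuclCone.ray 2 (b n)) (EuclCone.ray 2 (e n k)) o]

theorem isBounded_X : Bornology.IsBounded (Set.univ : Set X) :=
  Bornology.isBounded_image_subtype_val.1 <|
    Metric.isBounded_closedBall.subset (Set.image_univ.trans_subset (by
      rw [Subtype.range_coe]
      exact X_subset_closedBall))

/-! ### Weak closedness of `A` -/

theorem coe_inv_sqrt_two : ((1 / NNReal.sqrt 2 : ℝ≥0) : ℝ) = √2 / 2 := by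
  rw [NNReal.coe_div, NNReal.coe_one, Real.coe_sqrt, NNReal.coe_ofNat, Real.sqrt_div_self']

theorem inv_sqrt_two_le_one : (1 / NNReal.sqrt 2 : ℝ≥0) ≤ 1 := by
  rw [← NNReal.coe_le_coe, coe_inv_sqrt_two, ← Real.cos_pi_div_four]
  exact Real.cos_le_one _

theorem mem_A_iff (z : EuclCone Y) : z ∈ A ↔ (∃ n k, k ≠ 0 ∧ z = EuclCone.ray 1 (e n k)) ∨
    (∃ n, z = EuclCone.ray (1 / NNReal.sqrt 2) (b n)) ∨ z = EuclCone.ray (1 / 2) p ∨ z = o := by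
  simp only [A, E, B, Set.mem_union, Set.mem_image, Set.mem_ofPred_eq, Set.mem_singleton_iff,
    or_assoc]
  refine or_congr ⟨?_, ?_⟩ (or_congr ⟨?_, ?_⟩ Iff.rfl)
  · rintro ⟨_, ⟨n, k, hk, rfl⟩, rfl⟩
    exact ⟨n, k, Nat.one_le_iff_ne_zero.1 hk, rfl⟩
  · rintro ⟨n, k, hk, rfl⟩
    exact ⟨_, ⟨n, k, Nat.one_le_iff_ne_zero.2 hk, rfl⟩, rfl⟩
  · rintro ⟨_, ⟨n, rfl⟩, rfl⟩
    exact ⟨n, rfl⟩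
  · rintro ⟨n, rfl⟩
    exact ⟨_, ⟨n, rfl⟩, rfl⟩

theorem A_subset_X : A ⊆ X := by
  intro z hz
  rcases (mem_A_iff z).1 hz with ⟨n, k, -, rfl⟩ | ⟨n, rfl⟩ | rfl | rfl
  · exact ray_mem_X le_rfl _
  · exact ray_mem_X inv_sqrt_two_le_one _
  · exact ray_mem_X (NNReal.half_le_self 1) _
  · exact ray_mem_X zero_le_one _

theorem ray_endpoint_mem_A (n : ℕ) {k : ℕ} (hk : k ≠ 0) : EuclCone.ray 1 (e n k) ∈ A :=
  (mem_A_iff _).2 (Or.inl ⟨n, k, hk, rfl⟩)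

theorem ray_branch_mem_A (n : ℕ) : EuclCone.ray (1 / NNReal.sqrt 2) (b n) ∈ A :=
  (mem_A_iff _).2 (Or.inr (Or.inl ⟨n, rfl⟩))

theorem ray_half_mem_A : EuclCone.ray (1 / 2) p ∈ A :=
  (mem_A_iff _).2 (Or.inr (Or.inr (Or.inl rfl)))

theorem o_mem_A : o ∈ A :=
  (mem_A_iff _).2 (Or.inr (Or.inr (Or.inr rfl)))

theorem weakLimit_mem_A {u : ℕ → X} {x : X} (h : WeaklyConverges u x) {s σ τ : ℝ≥0} {θ : ℝ}
    {y w : Y} (hx : (x : EuclCone Y) = EuclCone.ray s y) (hτ : (τ : ℝ) = σ * Real.cos θ)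
    (hA : EuclCone.ray τ w ∈ A)
    (hu : ∃ᶠ n in Filter.atTop, ∃ v, (u n : EuclCone Y) = EuclCone.ray σ v ∧ dist v w = θ ∧
      MetricBetween v w y) :
    (x : EuclCone Y) ∈ A := by
  obtain ⟨γ, hγ, h0, hL⟩ := hasBarycentres_X.exists_geodesic x ⟨_, A_subset_X hA⟩
  rw [h.eq_of_frequently (isBounded_X.subset (Set.subset_univ _)) hγ h0 hL]
  · exact hA
  -- The weak limit and the foot `τ · w` of the perpendicular from `u n = σ · v` to the ray through
  -- `w` coincide because the triangle with these three vertices has an angle `≥ π/2` at the foot.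
  refine hu.mono fun n ⟨v, hv, hvw, hbtw⟩ => ?_
  rw [Subtype.dist_eq, Subtype.dist_eq, Subtype.dist_eq, hv, hx]
  exact EuclCone.dist_sq_add_dist_sq_le (by rw [hτ, hvw]) hbtw (dist_le_pi v y)

theorem weakLimit_mem_A_of_const {u : ℕ → X} {x : X} (h : WeaklyConverges u x) {z : EuclCone Y}
    (hz : z ∈ A) (hu : ∃ᶠ n in Filter.atTop, (u n : EuclCone Y) = z) : (x : EuclCone Y) ∈ A := by
  obtain ⟨s, y, hx⟩ := EuclCone.exists_ray (x : EuclCone Y)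
  obtain ⟨σ, v, rfl⟩ := EuclCone.exists_ray z
  refine weakLimit_mem_A h hx (θ := 0) (by rw [Real.cos_zero, mul_one]) hz
    (hu.mono fun n hn => ⟨v, hn, dist_self v, ?_⟩)
  rw [MetricBetween, dist_self, zero_add]

theorem weakLimit_mem_A_of_endpoints {u : ℕ → X} {x : X} (h : WeaklyConverges u x)
    (hu : ∃ᶠ j in Filter.atTop, ∃ n k, k ≠ 0 ∧ (u j : EuclCone Y) = EuclCone.ray 1 (e n k)) :
    (x : EuclCone Y) ∈ A := by
  obtain ⟨s, y, hx⟩ := EuclCone.exists_ray (x : EuclCone Y)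
  obtain ⟨n₀, k₀, t, rfl⟩ := exists_pt y
  have hcases : ∃ᶠ j in Filter.atTop,
      (∃ n k, n ≠ n₀ ∧ k ≠ 0 ∧ (u j : EuclCone Y) = EuclCone.ray 1 (e n k)) ∨
      (∃ k, k ≠ k₀ ∧ (u j : EuclCone Y) = EuclCone.ray 1 (e n₀ k)) ∨
      (k₀ ≠ 0 ∧ (u j : EuclCone Y) = EuclCone.ray 1 (e n₀ k₀)) :=
    hu.mono fun j ⟨n, k, hk, hj⟩ => by grind
  simp only [Filter.frequently_or_distrib] at hcases
  rcases hcases with hf | hf | hf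
  · refine weakLimit_mem_A h hx (τ := 0) (w := p) (θ := Real.pi / 2)
      (by rw [Real.cos_pi_div_two, mul_zero, NNReal.coe_zero]) o_mem_A
      (hf.mono fun j ⟨n, k, hn, hk, hj⟩ => ⟨e n k, hj, ?_, ?_⟩)
    · rw [dist_comm, dist_p_e n hk]
    · rw [e_eq_pt]
      exact metricBetween_p hn _ _ _ _
  · refine weakLimit_mem_A h hx (w := b n₀) (θ := Real.pi / 4)
      (by rw [Real.cos_pi_div_four, NNReal.coe_one, one_mul, coe_inv_sqrt_two])
      (ray_branch_mem_A n₀) (hf.mono fun j ⟨k, hk, hj⟩ => ⟨e n₀ k, hj, ?_, ?_⟩)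
    · rw [dist_comm, dist_b_e]
    · rw [e_eq_pt]
      exact metricBetween_b n₀ hk _ _
  · obtain ⟨-, hk, -⟩ := hf.exists
    exact weakLimit_mem_A_of_const h (ray_endpoint_mem_A n₀ hk) (hf.mono fun j => And.right)

theorem coe_half_eq_mul_cos : ((1 / 2 : ℝ≥0) : ℝ) =
    (1 / NNReal.sqrt 2 : ℝ≥0) * Real.cos (Real.pi / 4) := by
  rw [coe_inv_sqrt_two, Real.cos_pi_div_four, div_mul_div_comm, Real.mul_self_sqrt zero_le_two]
  norm_num

theorem weakLimit_mem_A_of_branches {u : ℕ → X} {x : X} (h : WeaklyConverges u x)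
    (hu : ∃ᶠ j in Filter.atTop, ∃ n,
      (u j : EuclCone Y) = EuclCone.ray (1 / NNReal.sqrt 2) (b n)) :
    (x : EuclCone Y) ∈ A := by
  obtain ⟨s, y, hx⟩ := EuclCone.exists_ray (x : EuclCone Y)
  obtain ⟨n₀, k₀, t, rfl⟩ := exists_pt y
  have hcases : ∃ᶠ j in Filter.atTop,
      (∃ n, n ≠ n₀ ∧ (u j : EuclCone Y) = EuclCone.ray (1 / NNReal.sqrt 2) (b n)) ∨
      (u j : EuclCone Y) = EuclCone.ray (1 / NNReal.sqrt 2) (b n₀) :=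
    hu.mono fun j ⟨n, hj⟩ => by grind
  rcases Filter.frequently_or_distrib.1 hcases with hf | hf
  · refine weakLimit_mem_A h hx coe_half_eq_mul_cos ray_half_mem_A
      (hf.mono fun j ⟨n, hn, hj⟩ => ⟨b n, hj, ?_, ?_⟩)
    · rw [dist_comm, dist_p_b]
    · rw [b_eq_pt n 0]
      exact metricBetween_p hn _ _ _ _
  · exact weakLimit_mem_A_of_const h (ray_branch_mem_A n₀) hf

theorem isWeaklyClosed_A : IsWeaklyClosed {x : X | (x : EuclCone Y) ∈ A} := by
  intro u x hu _ h
  have hf := Filter.Frequently.of_forall (f := Filter.atTop) fun n => (mem_A_iff _).1 (hu n)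
  simp only [Filter.frequently_or_distrib] at hf
  rcases hf with hf | hf | hf | hf
  · exact weakLimit_mem_A_of_endpoints h hf
  · exact weakLimit_mem_A_of_branches h hf
  · exact weakLimit_mem_A_of_const h ray_half_mem_A hf
  · exact weakLimit_mem_A_of_const h o_mem_A hf

/-! ### The point `(1/4) · p` and the coconvex closure of `A` -/

theorem quarter_p_notMem_A : EuclCone.ray (1 / 4) p ∉ A := by
  have hne : ∀ {s : ℝ≥0} {y : Y}, EuclCone.ray (1 / 4) p = EuclCone.ray s y → (s : ℝ) = 1 / 4 :=
    fun {s y} h => by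
      rw [← EuclCone.dist_ray_zero s y p, ← h, EuclCone.dist_ray_zero]
      norm_num
  intro hA
  rcases (mem_A_iff _).1 hA with ⟨n, k, -, h⟩ | ⟨n, h⟩ | h | h
  · exact absurd (hne h) (by norm_num)
  · have hs := hne h
    rw [coe_inv_sqrt_two] at hs
    linarith [Real.one_lt_sqrt_two]
  · exact absurd (hne h) (by norm_num)
  · exact absurd (hne h) (by norm_num)

/-- The point `(1/4) · p` of `X`. -/
noncomputable def quarterPoint : X :=
  ⟨EuclCone.ray (1 / 4) p, ray_mem_X (by rw [← NNReal.coe_le_coe]; norm_num) p⟩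

/-- The endpoints of `Y` at `b n`, as points of `X`. The shift in the index leaves out
`e n 0 = p`. -/
noncomputable def endPoint (n k : ℕ) : X :=
  ⟨EuclCone.ray 1 (e n (k + 1)), ray_mem_X le_rfl _⟩

theorem branch_mem_of_isGeodConvex {C : Set X} (hC : IsGeodConvex C) {n k l : ℕ} (hkl : k ≠ l)
    (hk : endPoint n k ∈ C) (hl : endPoint n l ∈ C) :
    ⟨EuclCone.ray (1 / NNReal.sqrt 2) (b n), A_subset_X (ray_branch_mem_A n)⟩ ∈ C := by
  refine hC _ hk _ hl _ (EuclCone.metricBetween_ray_of_right_angle ?_ ?_ (dist_b_e n _) ?_)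
  · rw [coe_inv_sqrt_two, Real.cos_pi_div_four, NNReal.coe_one, one_mul]
  · rw [dist_comm, dist_b_e]
  · rw [e_eq_pt, e_eq_pt]
    exact metricBetween_b n (by simpa using hkl) _ _

theorem quarterPoint_mem_of_isGeodConvex {C : Set X} (hC : IsGeodConvex C) {m n k l k' l' : ℕ}
    (hmn : m ≠ n) (hkl : k ≠ l) (hkl' : k' ≠ l') (hk : endPoint m k ∈ C)
    (hl : endPoint m l ∈ C) (hk' : endPoint n k' ∈ C) (hl' : endPoint n l' ∈ C) :
    quarterPoint ∈ C := by
  have hhalf : ⟨EuclCone.ray (1 / 2) p, A_subset_X ray_half_mem_A⟩ ∈ C := by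
    refine hC _ (branch_mem_of_isGeodConvex hC hkl hk hl) _
      (branch_mem_of_isGeodConvex hC hkl' hk' hl') _
      (EuclCone.metricBetween_ray_of_right_angle coe_half_eq_mul_cos ?_ (dist_p_b n) ?_)
    · rw [dist_comm, dist_p_b]
    · rw [b_eq_pt m 0, b_eq_pt n 0]
      exact metricBetween_p hmn _ _ _ _
  have htip : ⟨o, A_subset_X o_mem_A⟩ ∈ C := by
    refine hC _ hk _ hk' _ (EuclCone.metricBetween_ray_zero (Eq.ge ?_) 1 1)
    have hbtw : MetricBetween (e m (k + 1)) p (e n (k' + 1)) := by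
      rw [e_eq_pt, e_eq_pt]
      exact metricBetween_p hmn _ _ _ _
    rw [← hbtw, dist_comm, dist_p_e m k.succ_ne_zero, dist_p_e n k'.succ_ne_zero, add_halves]
  refine hC _ htip _ hhalf _ (EuclCone.metricBetween_ray zero_le ?_ p)
  rw [← NNReal.coe_le_coe]
  norm_num

theorem quarterPoint_mem_closure :
    quarterPoint ∈ @closure X (coconvexTopology X) {x : X | (x : EuclCone Y) ∈ A} := by
  refine mem_closure_coconvexTopology fun f hf hfC hA => ?_
  have : Finite f := hf
  have hcover : ∀ n k, ∃ C : f, endPoint n k ∈ (C : Set X) := fun n k => by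
    obtain ⟨C, hC, hmem⟩ := hA (ray_endpoint_mem_A n k.succ_ne_zero : endPoint n k ∈ _)
    exact ⟨⟨C, hC⟩, hmem⟩
  choose F hF using hcover
  obtain ⟨m, n, k, l, k', l', hmn, hkl, hkl', hml, hnk', hnl'⟩ := exists_monochromatic_pairs F
  exact ⟨F m k, (F m k).2, quarterPoint_mem_of_isGeodConvex (hfC _ (F m k).2).2 hmn hkl hkl'
    (hF m k) (hml ▸ hF m l) (hnk' ▸ hF n k') (hnl' ▸ hF n l')⟩

end Example

theorem mainTheorem9 :
    IsCAT0 Example.X ∧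
    Bornology.IsBounded (Set.univ : Set Example.X) ∧
    Example.A ⊆ Example.X ∧
    IsClosed[weakTopology Example.X] {x : Example.X | (x : EuclCone Example.Y) ∈ Example.A} ∧
    (∃ q : Example.X, (q : EuclCone Example.Y) = EuclCone.ray (1 / 4) Example.p ∧
      (q : EuclCone Example.Y) ∉ Example.A ∧
      q ∈ @closure Example.X (coconvexTopology Example.X)
        {x : Example.X | (x : EuclCone Example.Y) ∈ Example.A}) ∧
    weakTopology Example.X ≠ coconvexTopology Example.X := by
  have hclosed := isClosed_weakTopology_iff.2 Example.isWeaklyClosed_A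
  refine ⟨Example.hasBarycentres_X.isCAT0, Example.isBounded_X, Example.A_subset_X, hclosed,
    ⟨Example.quarterPoint, rfl, Example.quarter_p_notMem_A, Example.quarterPoint_mem_closure⟩,
    fun h => Example.quarter_p_notMem_A ?_⟩
  have hmem := Example.quarterPoint_mem_closure
  rw [h] at hclosed
  rwa [@IsClosed.closure_eq _ (coconvexTopology Example.X) _ hclosed] at hmem
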